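/- **Theorem.** Let $n\ge 1$. Denote by $H_{n,++}$ the set of positive definite matrices in $\mathbb C^{n\times n}$, and by $H_{n,+,1}\supset H_{n,++,1}$ the sets of positive semidefinite, respectively positive definite, Hermitian $n\times n$ matrices of trace $1$. Let $A_1,\dots,A_k\in\mathbb C^{n\times n}$ and $$Q(X)=\sum_{i=1}^k A_iXA_i^*,\qquad Q'(X)=\sum_{i=1}^k A_i^*XA_i,\qquad \tilde Q(X)=\frac{1}{\operatorname{tr}Q'(X)}\,Q'(X).$$ Assume that $Q$ is a positive quantum channel, that is, $\sum_i A_i^*A_i=I_n$ and $Q(X)\in H_{n,++}$ for every $X\in H_{n,+,1}$. Write $\lambda_1$ and $\lambda_n$ for the largest and the smallest eigenvalue of a matrix with real eigenvalues, and put $$a(Q)=\min_{X\in H_{n,+,1}}\lambda_n(Q(X)),\qquad b(Q)=\max_{X\in H_{n,+,1}}\lambda_1(Q(X)),\qquad \kappa=\frac{b(Q)-a(Q)}{b(Q)+a(Q)}.$$ For $X,Y\in H_{n,++}$ let $\operatorname{dist}(X,Y)=\log\lambda_1(XY^{-1})-\log\lambda_n(XY^{-1})$ (the Hilbert metric on rays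 of positive definite matrices). For a nonzero positive semidefinite $\alpha$ and $X\in H_{n,++}$ let $$D_\alpha(X)=\frac{1}{\operatorname{tr}(X^{-1}\alpha)}\,X^{-1/2}\alpha X^{-1/2},$$ and let $\Phi_{\alpha,\beta}=D_\alpha\circ\tilde Q\circ D_\beta\circ Q$ on $H_{n,+,1}$ and $\Theta=\Phi_{\frac1nI_n,\frac1nI_n}$. Then: 1. $0\le\kappa<1$, the maps $Q$ and $\tilde Q$ send $H_{n,++}$ to itself, and $\operatorname{dist}(Q(X),Q(Y))\le\kappa\operatorname{dist}(X,Y)$ and $\operatorname{dist}(\tilde Q(X),\tilde Q(Y))\le\kappa\operatorname{dist}(X,Y)$ for all $X,Y\in H_{n,++}$. 2. For every $t>0$, $D_{tI_n}$ maps $H_{n,++}$ to itself and $\operatorname{dist}(D_{tI_n}(X),D_{tI_n}(Y))=\operatorname{dist}(X,Y)$ for all $X,Y\in H_{n,++}$. 3. $\Theta$ maps $H_{n,++,1}$ to itself and $\operatorname{dist}(\Theta(X),\Theta(Y))\le\kappa^2\operatorname{dist}(X,Y)$ for all $X,Y\in H_{n,++,1}$. 4. $\Theta$ has a unique fixed point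 $F$ in $H_{n,+,1}$. It is positive definite, it lies in the relative interior of $H_{n,+,1}$, and $\Theta^{\circ m}(X)\to F$ as $m\to\infty$ for every $X\in H_{n,+,1}$. 5. There are $\varepsilon_1,\varepsilon_2>0$ such that the open Frobenius-norm balls $B_1$ and $B_2$ of radii $\varepsilon_1$ and $\varepsilon_2$, centered at $\frac1nI_n$ and $F$ respectively, in the space of Hermitian matrices of trace $1$, are contained in $H_{n,++,1}$, and such that for all $\alpha,\beta\in B_1$ the map $\Phi_{\alpha,\beta}$ has a unique fixed point $U(\alpha,\beta)$ in $H_{n,+,1}$, this fixed point lies in $B_2$, and $\Phi_{\alpha,\beta}^{\circ m}(X)\to U(\alpha,\beta)$ as $m\to\infty$ for every $X\in B_2$. -/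

import Mathlib

open scoped ComplexOrder

namespace QBridge

open scoped MatrixOrder Matrix

noncomputable section

/-- Density matrices: positive semidefinite complex matrices of trace one. -/
def density (n : ℕ) : Set (Matrix (Fin n) (Fin n) ℂ) :=
  {X | X.PosSemidef ∧ X.trace = 1}

/-- Positive definite density matrices. -/
def densityPD (n : ℕ) : Set (Matrix (Fin n) (Fin n) ℂ) :=
  {X | X.PosDef ∧ X.trace = 1}

/-- The completely positive operator `Q(X) = ∑ i, A i * X * (A i)ᴴ`. -/
def Q {n k : ℕ} (A : Fin k → Matrix (Fin n) (Fin n) ℂ) (X : Matrix (Fin n) (Fin n) ℂ) :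
    Matrix (Fin n) (Fin n) ℂ :=
  ∑ i, A i * X * (A i)ᴴ

/-- The dual operator `Q'(X) = ∑ i, (A i)ᴴ * X * A i`. -/
def Qdual {n k : ℕ} (A : Fin k → Matrix (Fin n) (Fin n) ℂ) (X : Matrix (Fin n) (Fin n) ℂ) :
    Matrix (Fin n) (Fin n) ℂ :=
  ∑ i, (A i)ᴴ * X * A i

/-- `Q` is a quantum channel: `∑ i, (A i)ᴴ * A i = I`. -/
def IsChannel {n k : ℕ} (A : Fin k → Matrix (Fin n) (Fin n) ℂ) : Prop :=
  ∑ i, (A i)ᴴ * A i = 1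

/-- `Q` is positive: it sends every density matrix to a positive definite matrix. -/
def IsPositive {n k : ℕ} (A : Fin k → Matrix (Fin n) (Fin n) ℂ) : Prop :=
  ∀ X ∈ density n, (Q A X).PosDef

/-- The largest real eigenvalue of a square complex matrix (used only for matrices all of whose
eigenvalues are real: Hermitian ones, and `X * Y⁻¹` with `X`, `Y` positive definite). -/
def lamMax {n : ℕ} (M : Matrix (Fin n) (Fin n) ℂ) : ℝ := sSup (spectrum ℝ M)

/-- The smallest real eigenvalue of a square complex matrix (used as `lamMax` is). -/
def lamMin {n : ℕ} (M : Matrix (Fin n) (Fin n) ℂ) : ℝ := sInf (spectrum ℝ M)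

/-- `a(Q)`, the minimum of the smallest eigenvalue of `Q(X)` over density matrices `X`. -/
def aConst {n k : ℕ} (A : Fin k → Matrix (Fin n) (Fin n) ℂ) : ℝ :=
  sInf ((fun X => lamMin (Q A X)) '' density n)

/-- `b(Q)`, the maximum of the largest eigenvalue of `Q(X)` over density matrices `X`. -/
def bConst {n k : ℕ} (A : Fin k → Matrix (Fin n) (Fin n) ℂ) : ℝ :=
  sSup ((fun X => lamMax (Q A X)) '' density n)

/-- `κ = (b(Q) - a(Q)) / (b(Q) + a(Q))`. -/
def kappa {n k : ℕ} (A : Fin k → Matrix (Fin n) (Fin n) ℂ) : ℝ :=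
  (bConst A - aConst A) / (bConst A + aConst A)

/-- The Hilbert metric `log λ₁(X Y⁻¹) - log λₙ(X Y⁻¹)` of positive definite matrices. -/
def hilbertDist {n : ℕ} (X Y : Matrix (Fin n) (Fin n) ℂ) : ℝ :=
  Real.log (lamMax (X * Y⁻¹)) - Real.log (lamMin (X * Y⁻¹))

/-- `D_α(X) = (tr (X⁻¹ α))⁻¹ X^(-1/2) α X^(-1/2)`. -/
def D {n : ℕ} (α X : Matrix (Fin n) (Fin n) ℂ) : Matrix (Fin n) (Fin n) ℂ :=
  (X⁻¹ * α).trace⁻¹ • ((CFC.sqrt X)⁻¹ * α * (CFC.sqrt X)⁻¹)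

/-- The normalized dual operator `X ↦ Q'(X) / tr Q'(X)`. -/
def Qtilde {n k : ℕ} (A : Fin k → Matrix (Fin n) (Fin n) ℂ) (X : Matrix (Fin n) (Fin n) ℂ) :
    Matrix (Fin n) (Fin n) ℂ :=
  (Qdual A X).trace⁻¹ • Qdual A X

/-- `Φ_{α,β} = D_α ∘ Q̃ ∘ D_β ∘ Q`. -/
def Phi {n k : ℕ} (A : Fin k → Matrix (Fin n) (Fin n) ℂ) (α β : Matrix (Fin n) (Fin n) ℂ) :
    Matrix (Fin n) (Fin n) ℂ → Matrix (Fin n) (Fin n) ℂ :=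
  D α ∘ Qtilde A ∘ D β ∘ Q A

/-- The uniform density matrix `(1/n) I`. -/
def unif (n : ℕ) : Matrix (Fin n) (Fin n) ℂ := (n : ℂ)⁻¹ • 1

/-- `Θ = Φ_{I/n, I/n}`. -/
def Theta {n k : ℕ} (A : Fin k → Matrix (Fin n) (Fin n) ℂ) :
    Matrix (Fin n) (Fin n) ℂ → Matrix (Fin n) (Fin n) ℂ :=
  Phi A (unif n) (unif n)

open scoped Matrix.Norms.Frobenius in
/-- The open ball for the Frobenius norm in the space of Hermitian matrices of trace one. -/
def frobBall {n : ℕ} (C : Matrix (Fin n) (Fin n) ℂ) (r : ℝ) : Set (Matrix (Fin n) (Fin n) ℂ) :=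
  {X | X.IsHermitian ∧ X.trace = 1 ∧ ‖X - C‖ < r}

end

end QBridge

/-!
The Hilbert distance is governed by the order: `hilbertDist X Y ≤ d` exactly when
`m • Y ≤ X ≤ (exp d * m) • Y` for some `m > 0`. If a linear map `L` sends states to matrices with
eigenvalues in `[a, b]`, then for `0 ≤ P, R` the images of `P` and `R` satisfy
`a (tr P) L R ≤ b (tr R) L P`, and writing `X = e^d P + R`, `Y = P + R` this gives Birkhoff's
contraction factor `(b - a) / (b + a)`. The self-duality of the positive semidefinite cone
transfers the bounds from `Q` to `Q'`. Inversion, normalization and scaling are isometries, so `Θ`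
contracts by `κ²`.

For `α` near a multiple of `I` the map `D α` is not an isometry, but it is Lipschitz, on matrices
with spectrum in a fixed interval, with a constant tending to `1`, and it stays close to `D 1`.
Hence `Φ_{α,β}` is still a contraction and moves `F` only slightly; the Banach fixed-point theorem
in the complete metric space of positive definite states gives both fixed points and puts the
second near the first.
-/

namespace QBridge

open scoped MatrixOrder Matrix

open Matrix Filter Topology

noncomputable section

section CStarAlgebra

theorem norm_conj_sub_conj_le {B : Type*} [NormedRing B] (R S δ : B) :
    ‖R * δ * R - S * δ * S‖ ≤ (‖R‖ + ‖S‖) * ‖S - R‖ * ‖δ‖ := by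
  have h_split : R * δ * R - S * δ * S = -((S - R) * δ * S + R * δ * (S - R)) := by noncomm_ring
  rw [h_split, norm_neg]
  calc ‖(S - R) * δ * S + R * δ * (S - R)‖
      ≤ ‖S - R‖ * ‖δ‖ * ‖S‖ + ‖R‖ * ‖δ‖ * ‖S - R‖ :=
        (norm_add_le _ _).trans (add_le_add (norm_mul₃_le ..) (norm_mul₃_le ..))
    _ = (‖R‖ + ‖S‖) * ‖S - R‖ * ‖δ‖ := by ring

variable {B : Type*} [CStarAlgebra B] [PartialOrder B] [StarOrderedRing B]

theorem le_smul_one_of_norm_le {H : B} (hH : IsSelfAdjoint H) {t : ℝ} (ht : ‖H‖ ≤ t) :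
    H ≤ t • (1 : B) := by
  rw [← Algebra.algebraMap_eq_smul_one]
  exact hH.le_algebraMap_norm_self.trans (algebraMap_mono B ht)

theorem neg_smul_one_le_of_norm_le {H : B} (hH : IsSelfAdjoint H) {t : ℝ} (ht : ‖H‖ ≤ t) :
    -(t • (1 : B)) ≤ H :=
  neg_le.1 (le_smul_one_of_norm_le hH.neg (by rwa [norm_neg]))

theorem le_of_mul_self_le_mul_self {R S : B} (hR : 0 ≤ R) (hS : 0 ≤ S) (h : R * R ≤ S * S) :
    R ≤ S := by
  simpa only [CFC.sqrt_mul_self R, CFC.sqrt_mul_self S] using CFC.sqrt_le_sqrt _ _ h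

theorem one_sub_smul_one_le {α : B} (hα : IsSelfAdjoint α) {τ : ℝ} (hτ : ‖α - 1‖ ≤ τ) :
    (1 - τ) • (1 : B) ≤ α := by
  have := neg_smul_one_le_of_norm_le (hα.sub (.one B)) hτ
  rw [le_sub_iff_add_le'] at this
  rwa [sub_smul, one_smul, sub_eq_add_neg]

theorem le_one_add_smul_one {α : B} (hα : IsSelfAdjoint α) {τ : ℝ} (hτ : ‖α - 1‖ ≤ τ) :
    α ≤ (1 + τ) • (1 : B) := by
  have := le_smul_one_of_norm_le (hα.sub (.one B)) hτ
  rwa [sub_le_iff_le_add', ← one_smul ℝ (1 : B), smul_smul, ← add_smul, mul_one] at this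

theorem norm_conj_sub_conj_le_of_one_sub_smul_le {R S : B} (hR : 0 ≤ R) (hRS : R ≤ S) {s : ℝ}
    (hs : 0 ≤ s) (hSR : (1 - s) • S ≤ R) (δ : B) :
    ‖R * δ * R - S * δ * S‖ ≤ 2 * s * ‖S‖ ^ 2 * ‖δ‖ := by
  have h_norm : ‖R‖ ≤ ‖S‖ := CStarAlgebra.norm_le_norm_of_nonneg_of_le hR hRS
  have h_norm_sub : ‖S - R‖ ≤ s * ‖S‖ := by
    have h_le : S - R ≤ s • S := by
      rw [sub_le_comm]
      rwa [sub_smul, one_smul] at hSR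
    simpa only [norm_smul, Real.norm_of_nonneg hs] using
      CStarAlgebra.norm_le_norm_of_nonneg_of_le (sub_nonneg.2 hRS) h_le
  calc ‖R * δ * R - S * δ * S‖ ≤ (‖R‖ + ‖S‖) * ‖S - R‖ * ‖δ‖ := norm_conj_sub_conj_le R S δ
    _ ≤ (‖S‖ + ‖S‖) * (s * ‖S‖) * ‖δ‖ := by gcongr
    _ = 2 * s * ‖S‖ ^ 2 * ‖δ‖ := by ring

theorem half_smul_mul_self_le_conj {S α : B} (hS : IsSelfAdjoint S) (hα : IsSelfAdjoint α)
    (h : ‖α - 1‖ ≤ 1 / 2) : (1 / 2 : ℝ) • (S * S) ≤ S * α * S := by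
  have h_half : (1 / 2 : ℝ) • (1 : B) ≤ α := by
    convert one_sub_smul_one_le hα h using 2
    norm_num
  have := hS.conjugate_le_conjugate h_half
  rwa [mul_smul_comm, mul_one, smul_mul_assoc] at this

/- Writing `α = 1 + δ`, the two conjugates differ by `R * R - S * S ≤ 0` and by the conjugates of
`δ`, whose difference is of second order: `O(τ * s)`. -/
theorem conj_le_smul_conj {R S α : B} (hR : 0 ≤ R) (hS : 0 ≤ S) (hα : IsSelfAdjoint α)
    {τ s m M : ℝ} (hτ : ‖α - 1‖ ≤ τ) (hτ' : τ ≤ 1 / 2) (hs : 0 ≤ s) (hm : 0 < m)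
    (hmS : m • (1 : B) ≤ S * S) (hSM : ‖S * S‖ ≤ M) (hRS : R * R ≤ S * S)
    (hSR : (1 - s) • S ≤ R) :
    R * α * R ≤ (1 + 4 * (M / m) * τ * s) • (S * α * S) := by
  have hS_adj : IsSelfAdjoint S := .of_nonneg hS
  have hδ : IsSelfAdjoint (α - 1) := hα.sub (.one B)
  have hτ₀ : 0 ≤ τ := (norm_nonneg _).trans hτ
  have hM₀ : 0 ≤ M := (norm_nonneg _).trans hSM
  have h_norm : ‖S‖ ^ 2 ≤ M := by
    rwa [sq, ← CStarRing.norm_star_mul_self, hS_adj.star_eq]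
  have h_remainder : R * (α - 1) * R - S * (α - 1) * S ≤ (2 * s * M * τ) • (1 : B) := by
    refine le_smul_one_of_norm_le
      ((hδ.conjugate_self (.of_nonneg hR)).sub (hδ.conjugate_self hS_adj)) ?_
    refine (norm_conj_sub_conj_le_of_one_sub_smul_le hR
      (le_of_mul_self_le_mul_self hR hS hRS) hs hSR _).trans ?_
    gcongr
  have h_one : (m / 2) • (1 : B) ≤ S * α * S := by
    refine le_trans ?_ (half_smul_mul_self_le_conj hS_adj hα (hτ.trans hτ'))
    rw [div_eq_inv_mul, mul_smul, ← one_div]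
    gcongr
  calc R * α * R = S * α * S + (R * R - S * S) + (R * (α - 1) * R - S * (α - 1) * S) := by
        noncomm_ring
    _ ≤ S * α * S + 0 + (2 * s * M * τ) • (1 : B) := by
        gcongr
        exact sub_nonpos.2 hRS
    _ = S * α * S + (4 * (M / m) * τ * s) • ((m / 2) • (1 : B)) := by
        rw [smul_smul, add_zero]
        congr 2
        field_simp
        ring
    _ ≤ S * α * S + (4 * (M / m) * τ * s) • (S * α * S) := by
        gcongr
    _ = (1 + 4 * (M / m) * τ * s) • (S * α * S) := by rw [add_smul, one_smul]

end CStarAlgebra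

section Loewner

variable {ι : Type*} {X Y : Matrix ι ι ℂ}

theorem posDef_of_le (hX : X.PosDef) (h : X ≤ Y) : Y.PosDef := by
  simpa only [add_sub_cancel] using hX.add_posSemidef (le_iff.1 h)

variable [Fintype ι]

theorem re_trace_mono (h : X ≤ Y) : X.trace.re ≤ Y.trace.re :=
  (Complex.le_def.1 (OrderHomClass.mono (tracePositiveLinearMap ι ℂ ℂ) h)).1

theorem re_trace_nonneg (hX : 0 ≤ X) : 0 ≤ X.trace.re :=
  (Complex.le_def.1 hX.posSemidef.trace_nonneg).1

theorem re_trace_pos [Nonempty ι] (hX : X.PosDef) : 0 < X.trace.re :=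
  (Complex.lt_def.1 hX.trace_pos).1

theorem ofReal_re_trace (hX : X.IsHermitian) : (X.trace.re : ℂ) = X.trace :=
  Complex.conj_eq_iff_re.1 (by rw [starRingEnd_apply, ← trace_conjTranspose, hX.eq])

theorem re_trace_mul_nonneg (hX : 0 ≤ X) (hY : 0 ≤ Y) : 0 ≤ (X * Y).trace.re := by
  classical
  obtain ⟨C, rfl⟩ := CStarAlgebra.nonneg_iff_eq_star_mul_self.mp hX
  rw [mul_assoc, trace_mul_comm, star_eq_conjTranspose]
  exact re_trace_nonneg (hY.posSemidef.mul_mul_conjTranspose_same C).nonneg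

theorem nonneg_iff_forall_re_trace_mul_nonneg (hX : X.IsHermitian) :
    0 ≤ X ↔ ∀ W : Matrix ι ι ℂ, 0 ≤ W → 0 ≤ (X * W).trace.re := by
  refine ⟨fun h W => re_trace_mul_nonneg h, fun h => ?_⟩
  rw [nonneg_iff_posSemidef, posSemidef_iff_dotProduct_mulVec]
  refine ⟨hX, fun u => Complex.le_def.2 ⟨?_, (hX.im_star_dotProduct_mulVec_self u).symm⟩⟩
  have := h (vecMulVec u (star u)) (posSemidef_vecMulVec_self_star u).nonneg
  rwa [mul_vecMulVec, trace_vecMulVec, dotProduct_comm] at this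

variable [DecidableEq ι]

theorem le_re_trace_smul_one (hX : 0 ≤ X) : X ≤ X.trace.re • (1 : Matrix ι ι ℂ) := by
  have hH : X.IsHermitian := hX.posSemidef.isHermitian
  rw [← Algebra.algebraMap_eq_smul_one, le_algebraMap_iff_spectrum_le (ha := hH),
    hH.spectrum_real_eq_range_eigenvalues, Set.forall_mem_range]
  have h_trace : X.trace.re = ∑ i, hH.eigenvalues i := by
    simp [hH.trace_eq_sum_eigenvalues]
  intro i
  rw [h_trace]
  exact Finset.single_le_sum (fun j _ => hX.posSemidef.eigenvalues_nonneg j) (Finset.mem_univ i)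

theorem inv_real_smul {r : ℝ} (hr : r ≠ 0) (hX : IsUnit X) : (r • X)⁻¹ = r⁻¹ • X⁻¹ := by
  refine inv_eq_left_inv ?_
  rw [smul_mul_smul_comm, inv_mul_cancel₀ hr, one_smul,
    nonsing_inv_mul _ ((isUnit_iff_isUnit_det X).1 hX)]

open scoped Matrix.Norms.L2Operator in
theorem inv_le_inv_of_posDef (hX : X.PosDef) (h : X ≤ Y) : Y⁻¹ ≤ X⁻¹ := by
  have := CStarAlgebra.inv_le_inv (a := hX.isUnit.unit) (b := (posDef_of_le hX h).isUnit.unit)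
    hX.posSemidef.nonneg h
  simpa only [coe_units_inv, IsUnit.unit_spec] using this

end Loewner

section ExtremeEigenvalues

variable {n : ℕ} {Z : Matrix (Fin n) (Fin n) ℂ}

theorem lamMax_eq_neg_lamMin_neg (Z : Matrix (Fin n) (Fin n) ℂ) : lamMax Z = -lamMin (-Z) := by
  rw [lamMax, lamMin, ← spectrum.neg_eq, Real.sInf_def, neg_neg, neg_neg]

variable [NeZero n]

theorem nonempty_spectrum (hZ : Z.IsHermitian) : (spectrum ℝ Z).Nonempty := by
  rw [hZ.spectrum_real_eq_range_eigenvalues]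
  exact Set.range_nonempty _

theorem isGreatest_lamMin (hZ : Z.IsHermitian) :
    IsGreatest {m : ℝ | m • (1 : Matrix (Fin n) (Fin n) ℂ) ≤ Z} (lamMin Z) := by
  have h_iff (m : ℝ) : m • (1 : Matrix (Fin n) (Fin n) ℂ) ≤ Z ↔ ∀ x ∈ spectrum ℝ Z, m ≤ x := by
    rw [← Algebra.algebraMap_eq_smul_one, algebraMap_le_iff_le_spectrum (ha := hZ)]
  simp_rw [h_iff]
  exact ⟨fun x hx => csInf_le finite_real_spectrum.bddBelow hx,
    fun m hm => le_csInf (nonempty_spectrum hZ) hm⟩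

theorem isLeast_lamMax (hZ : Z.IsHermitian) :
    IsLeast {M : ℝ | Z ≤ M • (1 : Matrix (Fin n) (Fin n) ℂ)} (lamMax Z) := by
  have h_iff (M : ℝ) : Z ≤ M • (1 : Matrix (Fin n) (Fin n) ℂ) ↔ ∀ x ∈ spectrum ℝ Z, x ≤ M := by
    rw [← Algebra.algebraMap_eq_smul_one, le_algebraMap_iff_spectrum_le (ha := hZ)]
  simp_rw [h_iff]
  exact ⟨fun x hx => le_csSup finite_real_spectrum.bddAbove hx,
    fun m hm => csSup_le (nonempty_spectrum hZ) hm⟩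

theorem lamMin_pos (hZ : Z.PosDef) : 0 < lamMin Z := by
  have h : lamMin Z ∈ spectrum ℝ Z :=
    (nonempty_spectrum hZ.isHermitian).csInf_mem finite_real_spectrum
  rw [hZ.isHermitian.spectrum_real_eq_range_eigenvalues] at h
  obtain ⟨i, hi⟩ := h
  exact hi ▸ hZ.eigenvalues_pos i

theorem lamMin_le_lamMax (hZ : Z.IsHermitian) : lamMin Z ≤ lamMax Z :=
  csInf_le_csSup (nonempty_spectrum hZ) finite_real_spectrum.bddBelow finite_real_spectrum.bddAbove

open scoped Matrix.Norms.L2Operator in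
theorem continuousOn_lamMin :
    ContinuousOn lamMin {Z : Matrix (Fin n) (Fin n) ℂ | Z.IsHermitian} := by
  have h_le : ∀ X Y : Matrix (Fin n) (Fin n) ℂ, X.IsHermitian → Y.IsHermitian →
      lamMin X - lamMin Y ≤ dist X Y := by
    intro X Y hX hY
    rw [sub_le_comm, dist_eq_norm]
    refine (isGreatest_lamMin hY).2 ?_
    have h := (isGreatest_lamMin hX).1.trans
      (sub_le_iff_le_add.1 (le_smul_one_of_norm_le (hX.sub hY).isSelfAdjoint le_rfl))
    rwa [Set.mem_ofPred_eq, sub_smul, sub_le_iff_le_add']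
  refine (LipschitzOnWith.of_dist_le_mul (K := 1) fun X hX Y hY => ?_).continuousOn
  rw [NNReal.coe_one, one_mul, Real.dist_eq]
  exact abs_sub_le_iff.2 ⟨h_le X Y hX hY, dist_comm X Y ▸ h_le Y X hY hX⟩

theorem continuousOn_lamMax :
    ContinuousOn lamMax {Z : Matrix (Fin n) (Fin n) ℂ | Z.IsHermitian} := by
  rw [funext lamMax_eq_neg_lamMin_neg]
  exact (continuousOn_lamMin.comp continuousOn_neg fun Z hZ => hZ.neg).neg

theorem eventually_posDef (hZ : Z.PosDef) : ∀ᶠ X in 𝓝[{X | X.IsHermitian}] Z, X.PosDef := by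
  have h_pos := (continuousOn_lamMin Z hZ.isHermitian).eventually_const_lt (lamMin_pos hZ)
  filter_upwards [h_pos, self_mem_nhdsWithin] with X h hX
  exact posDef_of_le (PosDef.one.smul h) (isGreatest_lamMin hX).1

end ExtremeEigenvalues

section InvSqrtConj

variable {ι : Type*} [Fintype ι] [DecidableEq ι] {X Y Z : Matrix ι ι ℂ}

/-- The congruence transform `Y^(-1/2) X Y^(-1/2)`. It is similar to `X Y⁻¹`, and up to the
normalization of the trace it is `D_X(Y)`. -/
def invSqrtConj (Y X : Matrix ι ι ℂ) : Matrix ι ι ℂ :=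
  (CFC.sqrt Y)⁻¹ * X * (CFC.sqrt Y)⁻¹

theorem posDef_sqrt (hY : Y.PosDef) : (CFC.sqrt Y).PosDef :=
  hY.isStrictlyPositive.sqrt.posDef

theorem inv_sqrt_mul_self (hY : Y.PosDef) : (CFC.sqrt Y)⁻¹ * (CFC.sqrt Y)⁻¹ = Y⁻¹ := by
  rw [← Matrix.mul_inv_rev, CFC.sqrt_mul_sqrt_self Y hY.posSemidef.nonneg]

theorem posDef_invSqrtConj (hY : Y.PosDef) (hX : X.PosDef) : (invSqrtConj Y X).PosDef := by
  have hS := (posDef_sqrt hY).inv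
  rw [← IsUnit.posDef_star_left_conjugate_iff hS.isUnit, star_eq_conjTranspose,
    hS.isHermitian.eq] at hX
  exact hX

theorem invSqrtConj_sub (Y X Z : Matrix ι ι ℂ) :
    invSqrtConj Y (X - Z) = invSqrtConj Y X - invSqrtConj Y Z := by
  rw [invSqrtConj, mul_sub, sub_mul, invSqrtConj, invSqrtConj]

theorem invSqrtConj_smul_right (r : ℝ) (Y X : Matrix ι ι ℂ) :
    invSqrtConj Y (r • X) = r • invSqrtConj Y X := by
  rw [invSqrtConj, mul_smul_comm, smul_mul_assoc, invSqrtConj]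

theorem invSqrtConj_smul_left {r : ℝ} (hr : 0 < r) (hY : Y.PosDef) (X : Matrix ι ι ℂ) :
    invSqrtConj (r • Y) X = r⁻¹ • invSqrtConj Y X := by
  have h_sqrt : CFC.sqrt (r • Y) = √r • CFC.sqrt Y := by
    refine CFC.sqrt_unique ?_ (smul_nonneg (Real.sqrt_nonneg r) (CFC.sqrt_nonneg Y))
    rw [smul_mul_smul_comm, Real.mul_self_sqrt hr.le,
      CFC.sqrt_mul_sqrt_self Y hY.posSemidef.nonneg]
  rw [invSqrtConj, h_sqrt, inv_real_smul (Real.sqrt_pos.2 hr).ne' (posDef_sqrt hY).isUnit,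
    smul_mul_assoc, smul_mul_smul_comm, ← mul_inv, Real.mul_self_sqrt hr.le, invSqrtConj]

theorem invSqrtConj_self (hY : Y.PosDef) : invSqrtConj Y Y = 1 := by
  have hdet := (isUnit_iff_isUnit_det _).1 (posDef_sqrt hY).isUnit
  conv_lhs => rw [invSqrtConj]; arg 1; arg 2; rw [← CFC.sqrt_mul_sqrt_self Y hY.posSemidef.nonneg]
  rw [nonsing_inv_mul_cancel_left _ _ hdet, mul_nonsing_inv _ hdet]

theorem invSqrtConj_one_right (hY : Y.PosDef) : invSqrtConj Y 1 = Y⁻¹ := by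
  rw [invSqrtConj, mul_one, inv_sqrt_mul_self hY]

theorem trace_invSqrtConj (hY : Y.PosDef) (X : Matrix ι ι ℂ) :
    (invSqrtConj Y X).trace = (Y⁻¹ * X).trace := by
  rw [invSqrtConj, trace_mul_comm, ← mul_assoc, inv_sqrt_mul_self hY]

theorem invSqrtConj_le_invSqrtConj_iff (hY : Y.PosDef) :
    invSqrtConj Y X ≤ invSqrtConj Y Z ↔ X ≤ Z := by
  have hS := (posDef_sqrt hY).inv
  rw [← sub_nonneg, ← invSqrtConj_sub, ← sub_nonneg (a := Z),
    ← hS.isUnit.star_left_conjugate_nonneg_iff (x := Z - X), star_eq_conjTranspose,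
    hS.isHermitian.eq, invSqrtConj]

theorem spectrum_mul_inv (hY : Y.PosDef) (X : Matrix ι ι ℂ) :
    spectrum ℝ (X * Y⁻¹) = spectrum ℝ (invSqrtConj Y X) := by
  obtain ⟨S, hS⟩ := (posDef_sqrt hY).isUnit
  have hdet := (isUnit_iff_isUnit_det _).1 (posDef_sqrt hY).isUnit
  have h_conj : X * Y⁻¹ = S.val * invSqrtConj Y X * S⁻¹.val := by
    rw [coe_units_inv, hS, invSqrtConj, ← inv_sqrt_mul_self hY, ← mul_assoc,
      mul_assoc (CFC.sqrt Y)⁻¹, mul_nonsing_inv_cancel_left _ _ hdet]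
  rw [h_conj, spectrum.units_conjugate]

variable {n : ℕ} [NeZero n] {X Y : Matrix (Fin n) (Fin n) ℂ}

theorem isGreatest_lamMin_mul_inv (hX : X.PosDef) (hY : Y.PosDef) :
    IsGreatest {m : ℝ | m • Y ≤ X} (lamMin (X * Y⁻¹)) := by
  have h_iff (m : ℝ) : m • Y ≤ X ↔ m • (1 : Matrix (Fin n) (Fin n) ℂ) ≤ invSqrtConj Y X := by
    rw [← invSqrtConj_le_invSqrtConj_iff hY, invSqrtConj_smul_right, invSqrtConj_self hY]
  simp_rw [h_iff, lamMin, spectrum_mul_inv hY]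
  exact isGreatest_lamMin (posDef_invSqrtConj hY hX).isHermitian

theorem isLeast_lamMax_mul_inv (hX : X.PosDef) (hY : Y.PosDef) :
    IsLeast {M : ℝ | X ≤ M • Y} (lamMax (X * Y⁻¹)) := by
  have h_iff (M : ℝ) : X ≤ M • Y ↔ invSqrtConj Y X ≤ M • (1 : Matrix (Fin n) (Fin n) ℂ) := by
    rw [← invSqrtConj_le_invSqrtConj_iff hY, invSqrtConj_smul_right, invSqrtConj_self hY]
  simp_rw [h_iff, lamMax, spectrum_mul_inv hY]
  exact isLeast_lamMax (posDef_invSqrtConj hY hX).isHermitian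

theorem lamMin_mul_inv_pos (hX : X.PosDef) (hY : Y.PosDef) : 0 < lamMin (X * Y⁻¹) := by
  rw [lamMin, spectrum_mul_inv hY]
  exact lamMin_pos (posDef_invSqrtConj hY hX)

theorem lamMin_mul_inv_le_lamMax_mul_inv (hX : X.PosDef) (hY : Y.PosDef) :
    lamMin (X * Y⁻¹) ≤ lamMax (X * Y⁻¹) := by
  rw [lamMin, lamMax, spectrum_mul_inv hY]
  exact lamMin_le_lamMax (posDef_invSqrtConj hY hX).isHermitian

end InvSqrtConj

section HilbertDist

variable {n : ℕ} [NeZero n] {W X Y : Matrix (Fin n) (Fin n) ℂ}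

theorem hilbertDist_nonneg (hX : X.PosDef) (hY : Y.PosDef) : 0 ≤ hilbertDist X Y :=
  sub_nonneg.2 <|
    Real.log_le_log (lamMin_mul_inv_pos hX hY) (lamMin_mul_inv_le_lamMax_mul_inv hX hY)

theorem hilbertDist_le_iff (hX : X.PosDef) (hY : Y.PosDef) {d : ℝ} :
    hilbertDist X Y ≤ d ↔ ∃ m > 0, m • Y ≤ X ∧ X ≤ (Real.exp d * m) • Y := by
  have hm := lamMin_mul_inv_pos hX hY
  have hM := hm.trans_le (lamMin_mul_inv_le_lamMax_mul_inv hX hY)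
  have h_dist : hilbertDist X Y ≤ d ↔ lamMax (X * Y⁻¹) ≤ Real.exp d * lamMin (X * Y⁻¹) := by
    rw [hilbertDist, ← Real.log_div hM.ne' hm.ne', Real.log_le_iff_le_exp (by positivity),
      div_le_iff₀ hm]
  rw [h_dist]
  constructor
  · exact fun h => ⟨_, hm, (isGreatest_lamMin_mul_inv hX hY).1,
      (isLeast_lamMax_mul_inv hX hY).1.trans (smul_le_smul_of_nonneg_right h hY.posSemidef.nonneg)⟩
  · rintro ⟨m, -, hmX, hXM⟩
    calc lamMax (X * Y⁻¹) ≤ Real.exp d * m := (isLeast_lamMax_mul_inv hX hY).2 hXM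
      _ ≤ Real.exp d * lamMin (X * Y⁻¹) := by
        gcongr
        exact (isGreatest_lamMin_mul_inv hX hY).2 hmX

theorem hilbertDist_le_of_le_of_le (hX : X.PosDef) (hY : Y.PosDef) {c m M : ℝ} (hm : 0 < m)
    (hmX : m • Y ≤ X) (hXM : X ≤ M • Y) (hc : M ≤ Real.exp c * m) : hilbertDist X Y ≤ c :=
  (hilbertDist_le_iff hX hY).2
    ⟨m, hm, hmX, hXM.trans (smul_le_smul_of_nonneg_right hc hY.posSemidef.nonneg)⟩

theorem hilbertDist_comm (hX : X.PosDef) (hY : Y.PosDef) : hilbertDist X Y = hilbertDist Y X := by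
  have h_le {X Y : Matrix (Fin n) (Fin n) ℂ} (hX : X.PosDef) (hY : Y.PosDef) :
      hilbertDist Y X ≤ hilbertDist X Y := by
    obtain ⟨m, hm, hmX, hXm⟩ := (hilbertDist_le_iff hX hY).1 le_rfl
    exact hilbertDist_le_of_le_of_le hY hX (m := (Real.exp (hilbertDist X Y) * m)⁻¹)
      (by positivity) ((inv_smul_le_iff_of_pos (by positivity)).2 hXm)
      ((le_inv_smul_iff_of_pos hm).2 hmX) (by field_simp; rfl)
  exact le_antisymm (h_le hY hX) (h_le hX hY)

theorem hilbertDist_triangle (hW : W.PosDef) (hX : X.PosDef) (hY : Y.PosDef) :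
    hilbertDist W Y ≤ hilbertDist W X + hilbertDist X Y := by
  obtain ⟨m, hm, hmW, hWm⟩ := (hilbertDist_le_iff hW hX).1 le_rfl
  obtain ⟨l, hl, hlX, hXl⟩ := (hilbertDist_le_iff hX hY).1 le_rfl
  refine (hilbertDist_le_iff hW hY).2 ⟨m * l, mul_pos hm hl, ?_, ?_⟩
  · rw [mul_smul]
    exact (smul_le_smul_of_nonneg_left hlX hm.le).trans hmW
  · rw [Real.exp_add, mul_mul_mul_comm, mul_smul]
    exact hWm.trans (smul_le_smul_of_nonneg_left hXl (by positivity))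

theorem hilbertDist_smul_left {r : ℝ} (hr : 0 < r) (hX : X.PosDef) (hY : Y.PosDef) :
    hilbertDist (r • X) Y = hilbertDist X Y := by
  have h_le {r : ℝ} (hr : 0 < r) {X : Matrix (Fin n) (Fin n) ℂ} (hX : X.PosDef) :
      hilbertDist (r • X) Y ≤ hilbertDist X Y := by
    obtain ⟨m, hm, hmX, hXm⟩ := (hilbertDist_le_iff hX hY).1 le_rfl
    refine (hilbertDist_le_iff (hX.smul hr) hY).2 ⟨r * m, mul_pos hr hm, ?_, ?_⟩
    · rw [mul_smul]
      exact smul_le_smul_of_nonneg_left hmX hr.le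
    · rw [mul_left_comm, mul_smul]
      exact smul_le_smul_of_nonneg_left hXm hr.le
  refine le_antisymm (h_le hr hX) ?_
  simpa only [inv_smul_smul₀ hr.ne'] using h_le (inv_pos.2 hr) (hX.smul hr)

theorem hilbertDist_smul_right {r : ℝ} (hr : 0 < r) (hX : X.PosDef) (hY : Y.PosDef) :
    hilbertDist X (r • Y) = hilbertDist X Y := by
  rw [hilbertDist_comm hX (hY.smul hr), hilbertDist_smul_left hr hY hX, hilbertDist_comm hY hX]

theorem hilbertDist_inv (hX : X.PosDef) (hY : Y.PosDef) :
    hilbertDist X⁻¹ Y⁻¹ = hilbertDist X Y := by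
  have h_le {X Y : Matrix (Fin n) (Fin n) ℂ} (hX : X.PosDef) (hY : Y.PosDef) :
      hilbertDist X⁻¹ Y⁻¹ ≤ hilbertDist X Y := by
    obtain ⟨m, hm, hmX, hXm⟩ := (hilbertDist_le_iff hX hY).1 le_rfl
    refine hilbertDist_le_of_le_of_le hX.inv hY.inv
      (m := (Real.exp (hilbertDist X Y) * m)⁻¹) (M := m⁻¹) (by positivity) ?_ ?_
      (by field_simp; rfl)
    · rw [← inv_real_smul (by positivity) hY.isUnit]
      exact inv_le_inv_of_posDef hX hXm
    · rw [← inv_real_smul hm.ne' hY.isUnit]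
      exact inv_le_inv_of_posDef (hY.smul hm) hmX
  refine le_antisymm (h_le hX hY) ?_
  have h_inv_inv {Z : Matrix (Fin n) (Fin n) ℂ} (hZ : Z.PosDef) : Z⁻¹⁻¹ = Z :=
    nonsing_inv_nonsing_inv Z ((isUnit_iff_isUnit_det Z).1 hZ.isUnit)
  simpa only [h_inv_inv hX, h_inv_inv hY] using h_le hX.inv hY.inv

end HilbertDist

section TraceNormalize

/-- The multiple of `M` of trace one, when the trace of `M` is nonzero (otherwise the junk value
`0`). -/
def traceNormalize {ι : Type*} [Fintype ι] (M : Matrix ι ι ℂ) : Matrix ι ι ℂ :=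
  M.trace⁻¹ • M

theorem traceNormalize_smul {ι : Type*} [Fintype ι] {r : ℝ} (hr : r ≠ 0) (M : Matrix ι ι ℂ) :
    traceNormalize (r • M) = traceNormalize M := by
  rw [traceNormalize, trace_smul, traceNormalize, ← Complex.coe_smul, ← Complex.coe_smul,
    smul_smul, smul_eq_mul, mul_inv, mul_right_comm,
    inv_mul_cancel₀ (Complex.ofReal_ne_zero.2 hr), one_mul]

theorem traceNormalize_eq_re_smul {ι : Type*} [Fintype ι] {M : Matrix ι ι ℂ}
    (hM : M.IsHermitian) : traceNormalize M = M.trace.re⁻¹ • M := by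
  rw [traceNormalize, ← ofReal_re_trace hM, ← Complex.ofReal_inv, Complex.coe_smul,
    Complex.ofReal_re]

variable {n : ℕ} {X Y α β : Matrix (Fin n) (Fin n) ℂ}

theorem D_eq_traceNormalize (hX : X.PosDef) (α : Matrix (Fin n) (Fin n) ℂ) :
    D α X = traceNormalize (invSqrtConj X α) := by
  rw [traceNormalize, trace_invSqrtConj hX, D, invSqrtConj]

theorem D_smul_left (hX : X.PosDef) {r : ℝ} (hr : r ≠ 0) (α : Matrix (Fin n) (Fin n) ℂ) :
    D (r • α) X = D α X := by
  rw [D_eq_traceNormalize hX, invSqrtConj_smul_right, traceNormalize_smul hr,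
    D_eq_traceNormalize hX]

theorem D_smul_right (hX : X.PosDef) {r : ℝ} (hr : 0 < r) (α : Matrix (Fin n) (Fin n) ℂ) :
    D α (r • X) = D α X := by
  rw [D_eq_traceNormalize (hX.smul hr), invSqrtConj_smul_left hr hX,
    traceNormalize_smul (inv_pos.2 hr).ne', D_eq_traceNormalize hX]

variable [NeZero n]

theorem traceNormalize_mem_densityPD (hX : X.PosDef) : traceNormalize X ∈ densityPD n := by
  constructor
  · rw [traceNormalize_eq_re_smul hX.isHermitian]
    exact hX.smul (inv_pos.2 (re_trace_pos hX))
  · rw [traceNormalize, trace_smul, smul_eq_mul, inv_mul_cancel₀ hX.trace_pos.ne']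

theorem hilbertDist_traceNormalize (hX : X.PosDef) (hY : Y.PosDef) :
    hilbertDist (traceNormalize X) (traceNormalize Y) = hilbertDist X Y := by
  have hX' := inv_pos.2 (re_trace_pos hX)
  have hY' := inv_pos.2 (re_trace_pos hY)
  rw [traceNormalize_eq_re_smul hX.isHermitian, traceNormalize_eq_re_smul hY.isHermitian,
    hilbertDist_smul_left hX' hX (hY.smul hY'), hilbertDist_smul_right hY' hX hY]

theorem D_traceNormalize (hX : X.PosDef) (α : Matrix (Fin n) (Fin n) ℂ) :
    D α (traceNormalize X) = D α X := by
  rw [traceNormalize_eq_re_smul hX.isHermitian, D_smul_right hX (inv_pos.2 (re_trace_pos hX))]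

theorem D_mem_densityPD (hα : α.PosDef) (hX : X.PosDef) : D α X ∈ densityPD n := by
  rw [D_eq_traceNormalize hX]
  exact traceNormalize_mem_densityPD (posDef_invSqrtConj hX hα)

theorem hilbertDist_D_D (hα : α.PosDef) (hβ : β.PosDef) (hX : X.PosDef) (hY : Y.PosDef) :
    hilbertDist (D α X) (D β Y) = hilbertDist (invSqrtConj X α) (invSqrtConj Y β) := by
  rw [D_eq_traceNormalize hX, D_eq_traceNormalize hY,
    hilbertDist_traceNormalize (posDef_invSqrtConj hX hα) (posDef_invSqrtConj hY hβ)]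

theorem hilbertDist_D_one (hX : X.PosDef) (hY : Y.PosDef) :
    hilbertDist (D 1 X) (D 1 Y) = hilbertDist X Y := by
  rw [hilbertDist_D_D .one .one hX hY, invSqrtConj_one_right hX, invSqrtConj_one_right hY,
    hilbertDist_inv hX hY]

end TraceNormalize

section Birkhoff

theorem mul_div_sub_mul_div_le {a b p r : ℝ} (ha : 0 < a) (hab : a ≤ b) (hp : 0 ≤ p)
    (hr : 0 < r) : b * p / (b * p + a * r) - a * p / (a * p + b * r) ≤ (b - a) / (b + a) := by
  have hb : 0 < b := ha.trans_le hab
  have h_sq : 0 ≤ a * b * (p - r) ^ 2 := by positivity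
  rw [div_sub_div _ _ (by positivity) (by positivity),
    div_le_div_iff₀ (by positivity) (by positivity)]
  nlinarith [mul_nonneg (sub_nonneg.2 hab) h_sq]

theorem exp_mul_add_mul_le {a b p r d : ℝ} (ha : 0 < a) (hab : a ≤ b) (hp : 0 ≤ p) (hr : 0 ≤ r)
    (hd : 0 ≤ d) :
    (Real.exp d * (b * p) + a * r) * (a * p + b * r) ≤
      Real.exp ((b - a) / (b + a) * d) * (Real.exp d * (a * p) + b * r) * (b * p + a * r) := by
  set κ := (b - a) / (b + a)
  have hb : 0 < b := ha.trans_le hab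
  have hκ₀ : 0 ≤ κ := div_nonneg (sub_nonneg.2 hab) (by positivity)
  rcases hr.eq_or_lt with rfl | hr
  · have : 1 ≤ Real.exp (κ * d) := Real.one_le_exp (mul_nonneg hκ₀ hd)
    nlinarith [show 0 ≤ Real.exp d * (b * p) * (a * p) by positivity]
  have h_deriv {c e : ℝ} (hc : 0 < c) (he : 0 < e) (t : ℝ) :
      HasDerivAt (fun t => Real.log (Real.exp t * (c * p) + e * r))
        (c * (p * Real.exp t) / (c * (p * Real.exp t) + e * r)) t := by
    have h := (((Real.hasDerivAt_exp t).mul_const (c * p)).add_const (e * r)).log (by positivity)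
    convert h using 1
    ring_nf
  have h_mono : Monotone fun t => κ * t + Real.log (Real.exp t * (a * p) + b * r) -
      Real.log (Real.exp t * (b * p) + a * r) := by
    refine monotone_of_hasDerivAt_nonneg
      (fun t => (((hasDerivAt_id t).const_mul κ).add (h_deriv ha hb t)).sub (h_deriv hb ha t))
      fun t => ?_
    have := mul_div_sub_mul_div_le ha hab (p := p * Real.exp t) (by positivity) hr
    simp only [Pi.zero_apply, mul_one]
    linarith
  have h_log := h_mono hd
  simp only [mul_zero, zero_add, Real.exp_zero, one_mul] at h_log
  rw [← Real.log_le_log_iff (by positivity) (by positivity),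
    Real.log_mul (by positivity) (by positivity), Real.log_mul (by positivity) (by positivity),
    Real.log_mul (by positivity) (by positivity), Real.log_exp]
  linarith

theorem smul_add_le_smul_smul_add {E : Type*} [AddCommGroup E] [PartialOrder E] [Module ℝ E]
    [IsOrderedAddMonoid E] [PosSMulMono ℝ E] {U V : E} {e s t : ℝ} (he : 1 ≤ e)
    (h : s • V ≤ t • U) : (e * s + t) • (U + V) ≤ (s + t) • (e • U + V) := by
  have h_diff : (s + t) • (e • U + V) - (e * s + t) • (U + V) = (e - 1) • (t • U - s • V) := by
    module
  rw [← sub_nonneg, h_diff]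
  exact smul_nonneg (sub_nonneg.2 he) (sub_nonneg.2 h)

theorem smul_smul_add_le_smul_add {E : Type*} [AddCommGroup E] [PartialOrder E] [Module ℝ E]
    [IsOrderedAddMonoid E] [PosSMulMono ℝ E] {U V : E} {e s t : ℝ} (he : 1 ≤ e)
    (h : t • U ≤ s • V) : (s + t) • (e • U + V) ≤ (e * s + t) • (U + V) := by
  have h_diff : (e * s + t) • (U + V) - (s + t) • (e • U + V) = (e - 1) • (s • V - t • U) := by
    module
  rw [← sub_nonneg, h_diff]
  exact smul_nonneg (sub_nonneg.2 he) (sub_nonneg.2 h)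

variable {ι ι' : Type*} [Fintype ι] [DecidableEq ι'] {a b : ℝ}

/-- The linear map `L` sends every positive semidefinite matrix of trace one to a Hermitian
matrix with eigenvalues in `[a, b]`; this is stated homogeneously. -/
def IsTraceBounded (a b : ℝ) (L : Matrix ι ι ℂ →ₗ[ℝ] Matrix ι' ι' ℂ) : Prop :=
  ∀ X, 0 ≤ X → (a * X.trace.re) • (1 : Matrix ι' ι' ℂ) ≤ L X ∧
    L X ≤ (b * X.trace.re) • (1 : Matrix ι' ι' ℂ)

theorem IsTraceBounded.posDef [Nonempty ι] {L : Matrix ι ι ℂ →ₗ[ℝ] Matrix ι' ι' ℂ}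
    (hL : IsTraceBounded a b L) (ha : 0 < a) {X : Matrix ι ι ℂ} (hX : X.PosDef) : (L X).PosDef :=
  posDef_of_le (PosDef.one.smul (mul_pos ha (re_trace_pos hX))) (hL X hX.posSemidef.nonneg).1

theorem IsTraceBounded.smul_le_smul [Finite ι'] {L : Matrix ι ι ℂ →ₗ[ℝ] Matrix ι' ι' ℂ}
    (hL : IsTraceBounded a b L) (ha : 0 ≤ a) (hb : 0 ≤ b) {P R : Matrix ι ι ℂ} (hP : 0 ≤ P)
    (hR : 0 ≤ R) : (a * P.trace.re) • L R ≤ (b * R.trace.re) • L P := by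
  have := Fintype.ofFinite ι'
  have hp : 0 ≤ P.trace.re := re_trace_nonneg hP
  have hr : 0 ≤ R.trace.re := re_trace_nonneg hR
  calc (a * P.trace.re) • L R ≤ (a * P.trace.re) • (b * R.trace.re) • (1 : Matrix ι' ι' ℂ) :=
        smul_le_smul_of_nonneg_left (hL R hR).2 (by positivity)
    _ = (b * R.trace.re) • (a * P.trace.re) • (1 : Matrix ι' ι' ℂ) := smul_comm _ _ _
    _ ≤ (b * R.trace.re) • L P := smul_le_smul_of_nonneg_left (hL P hP).1 (by positivity)

theorem IsTraceBounded.dual [DecidableEq ι] [Fintype ι'] {L : Matrix ι ι ℂ →ₗ[ℝ] Matrix ι' ι' ℂ}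
    {L' : Matrix ι' ι' ℂ →ₗ[ℝ] Matrix ι ι ℂ} (hL : IsTraceBounded a b L)
    (h_herm : ∀ X, X.IsHermitian → (L' X).IsHermitian)
    (h_dual : ∀ X W, (L' X * W).trace = (X * L W).trace) : IsTraceBounded a b L' := by
  intro X hX
  have h_one (c : ℝ) : (c • (1 : Matrix ι ι ℂ)).IsHermitian := isHermitian_one.smul (.all c)
  have hL'X := h_herm X hX.posSemidef.isHermitian
  constructor
  · rw [← sub_nonneg, nonneg_iff_forall_re_trace_mul_nonneg (hL'X.sub (h_one _))]
    intro W hW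
    have := re_trace_mul_nonneg hX (sub_nonneg.2 (hL W hW).1)
    simp only [mul_sub, sub_mul, trace_sub, h_dual, mul_smul_comm, smul_mul_assoc, mul_one,
      one_mul, trace_smul, Complex.sub_re, Complex.real_smul, Complex.re_ofReal_mul] at this ⊢
    linarith
  · rw [← sub_nonneg, nonneg_iff_forall_re_trace_mul_nonneg ((h_one _).sub hL'X)]
    intro W hW
    have := re_trace_mul_nonneg hX (sub_nonneg.2 (hL W hW).2)
    simp only [mul_sub, sub_mul, trace_sub, h_dual, mul_smul_comm, smul_mul_assoc, mul_one,
      one_mul, trace_smul, Complex.sub_re, Complex.real_smul, Complex.re_ofReal_mul] at this ⊢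
    linarith

variable {n m : ℕ} [NeZero n] [NeZero m]

theorem hilbertDist_smul_add_le {L : Matrix (Fin n) (Fin n) ℂ →ₗ[ℝ] Matrix (Fin m) (Fin m) ℂ}
    (hL : IsTraceBounded a b L) (ha : 0 < a) (hab : a ≤ b) {P R : Matrix (Fin n) (Fin n) ℂ}
    (hP : 0 ≤ P) (hR : 0 ≤ R) (hPR : (P + R).PosDef) {d : ℝ} (hd : 0 ≤ d) :
    hilbertDist (L (Real.exp d • P + R)) (L (P + R)) ≤ (b - a) / (b + a) * d := by
  have hb : 0 < b := ha.trans_le hab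
  have he : 1 ≤ Real.exp d := Real.one_le_exp hd
  have hp : 0 ≤ P.trace.re := re_trace_nonneg hP
  have hr : 0 ≤ R.trace.re := re_trace_nonneg hR
  have hpr : 0 < P.trace.re + R.trace.re := by
    simpa only [trace_add, Complex.add_re] using re_trace_pos hPR
  set p := P.trace.re
  set r := R.trace.re
  have h_pos {c e : ℝ} (hc : 0 < c) (he : 0 < e) : 0 < c * p + e * r := by
    rcases hp.eq_or_lt with h | h
    · have : 0 < r := by linarith
      positivity
    · positivity
  have h_le : P + R ≤ Real.exp d • P + R :=
    add_le_add_left (le_smul_of_one_le_left hP he) R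
  have h_lower := smul_add_le_smul_smul_add he (hL.smul_le_smul ha.le hb.le hP hR)
  have h_upper := smul_smul_add_le_smul_add he (hL.smul_le_smul ha.le hb.le hR hP)
  rw [← map_smul, ← map_add, ← map_add] at h_lower h_upper
  refine hilbertDist_le_of_le_of_le (hL.posDef ha (posDef_of_le hPR h_le)) (hL.posDef ha hPR)
    (m := (Real.exp d * (a * p) + b * r) / (a * p + b * r))
    (M := (Real.exp d * (b * p) + a * r) / (b * p + a * r)) ?_ ?_ ?_ ?_
  · have := h_pos (mul_pos (Real.exp_pos d) ha) hb
    exact div_pos (by linarith) (h_pos ha hb)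
  · rw [div_eq_inv_mul, mul_smul]
    exact (inv_smul_le_iff_of_pos (h_pos ha hb)).2 h_lower
  · rw [div_eq_inv_mul, mul_smul]
    exact (le_inv_smul_iff_of_pos (h_pos hb ha)).2 h_upper
  · rw [← mul_div_assoc, div_le_div_iff₀ (h_pos hb ha) (h_pos ha hb)]
    exact exp_mul_add_mul_le ha hab hp hr hd

theorem IsTraceBounded.hilbertDist_le
    {L : Matrix (Fin n) (Fin n) ℂ →ₗ[ℝ] Matrix (Fin m) (Fin m) ℂ} (hL : IsTraceBounded a b L)
    (ha : 0 < a) (hab : a ≤ b) {X Y : Matrix (Fin n) (Fin n) ℂ} (hX : X.PosDef) (hY : Y.PosDef) :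
    hilbertDist (L X) (L Y) ≤ (b - a) / (b + a) * hilbertDist X Y := by
  obtain ⟨m, hm, hmX, hXm⟩ := (hilbertDist_le_iff hX hY).1 le_rfl
  have hLX := hL.posDef ha hX
  have hLY := hL.posDef ha hY
  rcases (hilbertDist_nonneg hX hY).eq_or_lt with hd | hd
  · rw [← hd, Real.exp_zero, one_mul] at hXm
    rw [← hd, mul_zero]
    have hX_eq : L X = m • L Y := by rw [hXm.antisymm hmX, map_smul]
    exact hilbertDist_le_of_le_of_le hLX hLY hm hX_eq.ge hX_eq.le (by simp)
  set d := hilbertDist X Y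
  have he : 0 < Real.exp d - 1 := sub_pos.2 (Real.one_lt_exp_iff.2 hd)
  have hY_eq : (X - m • Y) + ((Real.exp d * m) • Y - X) = ((Real.exp d - 1) * m) • Y := by module
  have hX_eq : Real.exp d • (X - m • Y) + ((Real.exp d * m) • Y - X) = (Real.exp d - 1) • X := by
    module
  have h := hilbertDist_smul_add_le hL ha hab (sub_nonneg.2 hmX) (sub_nonneg.2 hXm)
    (hY_eq ▸ hY.smul (mul_pos he hm)) hd.le
  rwa [hX_eq, hY_eq, map_smul, map_smul, hilbertDist_smul_left he hLX (hLY.smul (mul_pos he hm)),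
    hilbertDist_smul_right (mul_pos he hm) hLX hLY] at h

end Birkhoff

section Channel

variable {n k : ℕ} {X : Matrix (Fin n) (Fin n) ℂ}

open scoped Matrix.Norms.L2Operator in
theorem isClosed_density : IsClosed (density n) := by
  have h_nonneg : IsClosed {X : Matrix (Fin n) (Fin n) ℂ | X.PosSemidef} := by
    simp only [← nonneg_iff_posSemidef]
    exact isClosed_Ici
  exact h_nonneg.inter (isClosed_eq continuous_id.matrix_trace continuous_const)

open scoped Matrix.Norms.L2Operator in
theorem norm_le_one_of_mem_density (hX : X ∈ density n) : ‖X‖ ≤ 1 := by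
  rw [CStarAlgebra.norm_le_iff_le_algebraMap _ zero_le_one hX.1.nonneg, map_one]
  simpa only [hX.2, Complex.one_re, one_smul] using le_re_trace_smul_one hX.1.nonneg

open scoped Matrix.Norms.L2Operator in
theorem isCompact_density : IsCompact (density n) := by
  have : ProperSpace (Matrix (Fin n) (Fin n) ℂ) := FiniteDimensional.proper ℂ _
  exact Metric.isCompact_of_isClosed_isBounded isClosed_density
    (Metric.isBounded_closedBall.subset fun X hX =>
      mem_closedBall_zero_iff.2 (norm_le_one_of_mem_density hX))

theorem unif_eq_smul_one (n : ℕ) : unif n = (n : ℝ)⁻¹ • 1 := by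
  rw [unif, ← Complex.coe_smul, Complex.ofReal_inv, Complex.ofReal_natCast]

theorem unif_mem_densityPD [NeZero n] : unif n ∈ densityPD n := by
  refine ⟨unif_eq_smul_one n ▸ PosDef.one.smul (inv_pos.2 (Nat.cast_pos.2 (NeZero.pos n))), ?_⟩
  rw [unif, trace_smul, trace_one, Fintype.card_fin, smul_eq_mul,
    inv_mul_cancel₀ (NeZero.ne _)]

theorem densityPD_subset_density : densityPD n ⊆ density n :=
  fun _ hX => ⟨hX.1.posSemidef, hX.2⟩

theorem isTraceBounded_of_forall_density {m : ℕ} {a b : ℝ}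
    {L : Matrix (Fin n) (Fin n) ℂ →ₗ[ℝ] Matrix (Fin m) (Fin m) ℂ}
    (hL : ∀ X ∈ density n, a • 1 ≤ L X ∧ L X ≤ b • 1) : IsTraceBounded a b L := by
  intro X hX
  have h_trace := ofReal_re_trace hX.posSemidef.isHermitian
  rcases (re_trace_nonneg hX).eq_or_lt with h | h
  · have hX₀ : X = 0 := by
      rw [← hX.posSemidef.trace_eq_zero_iff, ← h_trace, ← h, Complex.ofReal_zero]
    simp [hX₀]
  · obtain ⟨h_lower, h_upper⟩ := hL (X.trace.re⁻¹ • X)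
      ⟨hX.posSemidef.smul (inv_nonneg.2 h.le), by
        rw [trace_smul, ← h_trace, ← Complex.coe_smul, smul_eq_mul, Complex.ofReal_inv,
          Complex.ofReal_re, inv_mul_cancel₀ (Complex.ofReal_ne_zero.2 h.ne')]⟩
    rw [map_smul] at h_lower h_upper
    rw [mul_comm a, mul_comm b, mul_smul, mul_smul]
    exact ⟨(le_inv_smul_iff_of_pos h).1 h_lower, (inv_smul_le_iff_of_pos h).1 h_upper⟩

/-- The operator `Q` as a real linear map. -/
def QLinear (A : Fin k → Matrix (Fin n) (Fin n) ℂ) :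
    Matrix (Fin n) (Fin n) ℂ →ₗ[ℝ] Matrix (Fin n) (Fin n) ℂ where
  toFun := Q A
  map_add' X Y := by simp only [Q, mul_add, add_mul, Finset.sum_add_distrib]
  map_smul' r X := by
    simp only [Q, mul_smul_comm, smul_mul_assoc, Finset.smul_sum, RingHom.id_apply]

/-- The operator `Q'` as a real linear map. -/
def QdualLinear (A : Fin k → Matrix (Fin n) (Fin n) ℂ) :
    Matrix (Fin n) (Fin n) ℂ →ₗ[ℝ] Matrix (Fin n) (Fin n) ℂ where
  toFun := Qdual A
  map_add' X Y := by simp only [Qdual, mul_add, add_mul, Finset.sum_add_distrib]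
  map_smul' r X := by
    simp only [Qdual, mul_smul_comm, smul_mul_assoc, Finset.smul_sum, RingHom.id_apply]

variable {A : Fin k → Matrix (Fin n) (Fin n) ℂ}

theorem Qdual_isHermitian (hX : X.IsHermitian) : (Qdual A X).IsHermitian := by
  simp only [IsHermitian, Qdual, conjTranspose_sum, conjTranspose_mul, conjTranspose_conjTranspose,
    hX.eq, mul_assoc]

theorem trace_Qdual_mul (X W : Matrix (Fin n) (Fin n) ℂ) :
    (Qdual A X * W).trace = (X * Q A W).trace := by
  simp only [Qdual, Q, Finset.sum_mul, Finset.mul_sum, trace_sum]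
  refine Finset.sum_congr rfl fun i _ => ?_
  rw [mul_assoc, mul_assoc, trace_mul_comm, mul_assoc, mul_assoc]

theorem continuous_Q : Continuous (Q A) := by
  unfold Q
  fun_prop

variable [NeZero n]

theorem continuousOn_lamMin_Q (hA : IsPositive A) :
    ContinuousOn (fun X => lamMin (Q A X)) (density n) :=
  continuousOn_lamMin.comp continuous_Q.continuousOn fun X hX => (hA X hX).isHermitian

theorem continuousOn_lamMax_Q (hA : IsPositive A) :
    ContinuousOn (fun X => lamMax (Q A X)) (density n) :=
  continuousOn_lamMax.comp continuous_Q.continuousOn fun X hX => (hA X hX).isHermitian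

theorem aConst_pos (hA : IsPositive A) : 0 < aConst A := by
  obtain ⟨X, hX, h_eq⟩ := isCompact_density.exists_sInf_image_eq
    ⟨_, densityPD_subset_density unif_mem_densityPD⟩ (continuousOn_lamMin_Q hA)
  exact (lamMin_pos (hA X hX)).trans_eq h_eq.symm

theorem aConst_smul_one_le_Q (hA : IsPositive A) (hX : X ∈ density n) :
    aConst A • 1 ≤ Q A X :=
  (smul_le_smul_of_nonneg_right (csInf_le (isCompact_density.bddBelow_image
    (continuousOn_lamMin_Q hA)) (Set.mem_image_of_mem _ hX)) zero_le_one).trans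
    (isGreatest_lamMin (hA X hX).isHermitian).1

theorem Q_le_bConst_smul_one (hA : IsPositive A) (hX : X ∈ density n) :
    Q A X ≤ bConst A • 1 :=
  (isLeast_lamMax (hA X hX).isHermitian).1.trans
    (smul_le_smul_of_nonneg_right (le_csSup (isCompact_density.bddAbove_image
      (continuousOn_lamMax_Q hA)) (Set.mem_image_of_mem _ hX)) zero_le_one)

theorem aConst_le_bConst (hA : IsPositive A) : aConst A ≤ bConst A := by
  have hU := densityPD_subset_density (unif_mem_densityPD (n := n))
  exact (csInf_le (isCompact_density.bddBelow_image (continuousOn_lamMin_Q hA))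
    (Set.mem_image_of_mem _ hU)).trans <| (lamMin_le_lamMax (hA _ hU).isHermitian).trans <|
    le_csSup (isCompact_density.bddAbove_image (continuousOn_lamMax_Q hA))
      (Set.mem_image_of_mem _ hU)

theorem kappa_nonneg (hA : IsPositive A) : 0 ≤ kappa A :=
  div_nonneg (sub_nonneg.2 (aConst_le_bConst hA))
    (by linarith [aConst_pos hA, aConst_le_bConst hA])

theorem kappa_lt_one (hA : IsPositive A) : kappa A < 1 := by
  have ha := aConst_pos hA
  have hab := aConst_le_bConst hA
  rw [kappa, div_lt_one (by linarith)]
  linarith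

theorem isTraceBounded_Q (hA : IsPositive A) :
    IsTraceBounded (aConst A) (bConst A) (QLinear A) :=
  isTraceBounded_of_forall_density fun _ hX =>
    ⟨aConst_smul_one_le_Q hA hX, Q_le_bConst_smul_one hA hX⟩

theorem isTraceBounded_Qdual (hA : IsPositive A) :
    IsTraceBounded (aConst A) (bConst A) (QdualLinear A) :=
  (isTraceBounded_Q hA).dual (fun _ => Qdual_isHermitian) trace_Qdual_mul

theorem posDef_Q (hA : IsPositive A) (hX : X.PosDef) : (Q A X).PosDef :=
  (isTraceBounded_Q hA).posDef (aConst_pos hA) hX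

theorem posDef_Qdual (hA : IsPositive A) (hX : X.PosDef) : (Qdual A X).PosDef :=
  (isTraceBounded_Qdual hA).posDef (aConst_pos hA) hX

theorem Qtilde_mem_densityPD (hA : IsPositive A) (hX : X.PosDef) : Qtilde A X ∈ densityPD n :=
  traceNormalize_mem_densityPD (posDef_Qdual hA hX)

variable {Y : Matrix (Fin n) (Fin n) ℂ}

theorem hilbertDist_Q_le (hA : IsPositive A) (hX : X.PosDef) (hY : Y.PosDef) :
    hilbertDist (Q A X) (Q A Y) ≤ kappa A * hilbertDist X Y :=
  (isTraceBounded_Q hA).hilbertDist_le (aConst_pos hA) (aConst_le_bConst hA) hX hY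

theorem hilbertDist_Qtilde_le (hA : IsPositive A) (hX : X.PosDef) (hY : Y.PosDef) :
    hilbertDist (Qtilde A X) (Qtilde A Y) ≤ kappa A * hilbertDist X Y :=
  (hilbertDist_traceNormalize (posDef_Qdual hA hX) (posDef_Qdual hA hY)).trans_le
    ((isTraceBounded_Qdual hA).hilbertDist_le (aConst_pos hA) (aConst_le_bConst hA) hX hY)

end Channel

section NearIdentity

open scoped Matrix.Norms.L2Operator

variable {n : ℕ} {X Y α : Matrix (Fin n) (Fin n) ℂ} {c d τ : ℝ}

theorem invSqrtConj_le_smul_invSqrtConj (hα : α.IsHermitian) (hτ : ‖α - 1‖ ≤ τ) (hτ' : τ ≤ 1 / 2)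
    (hc : 0 < c) (hd : 0 < d) (hY : Y.PosDef) (hcY : c • 1 ≤ Y) (hYd : Y ≤ d • 1) {s : ℝ}
    (hs : 0 ≤ s) (hYX : Y ≤ X) (hXY : X ≤ Real.exp (2 * s) • Y) :
    invSqrtConj X α ≤ (1 + 4 * (d / c) * τ * s) • invSqrtConj Y α := by
  have hX : X.PosDef := posDef_of_le hY hYX
  have hR := (posDef_sqrt hX).inv.posSemidef.nonneg
  have hS := (posDef_sqrt hY).inv.posSemidef.nonneg
  have h_inv_le : Y⁻¹ ≤ c⁻¹ • 1 := by
    simpa only [inv_real_smul hc.ne' isUnit_one, inv_one] using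
      inv_le_inv_of_posDef (PosDef.one.smul hc) hcY
  have h_le_inv : d⁻¹ • 1 ≤ Y⁻¹ := by
    simpa only [inv_real_smul hd.ne' isUnit_one, inv_one] using inv_le_inv_of_posDef hY hYd
  have h_norm : ‖Y⁻¹‖ ≤ c⁻¹ := by
    rwa [CStarAlgebra.norm_le_iff_le_algebraMap _ (inv_nonneg.2 hc.le)
      hY.inv.posSemidef.nonneg, Algebra.algebraMap_eq_smul_one]
  have h_exp : Real.exp (-s) * Real.exp (-s) = (Real.exp (2 * s))⁻¹ := by
    rw [← Real.exp_add, ← Real.exp_neg]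
    ring_nf
  have h_sqrt : Real.exp (-s) • (CFC.sqrt Y)⁻¹ ≤ (CFC.sqrt X)⁻¹ := by
    refine le_of_mul_self_le_mul_self (smul_nonneg (Real.exp_pos _).le hS) hR ?_
    rw [smul_mul_smul_comm, inv_sqrt_mul_self hX, inv_sqrt_mul_self hY, h_exp,
      ← inv_real_smul (Real.exp_pos _).ne' hY.isUnit]
    exact inv_le_inv_of_posDef hX hXY
  have h_one_sub : (1 - s) • (CFC.sqrt Y)⁻¹ ≤ (CFC.sqrt X)⁻¹ :=
    (smul_le_smul_of_nonneg_right (Real.one_sub_le_exp_neg s) hS).trans h_sqrt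
  rw [← inv_div_inv c d]
  refine conj_le_smul_conj hR hS hα.isSelfAdjoint hτ hτ' hs (inv_pos.2 hd) ?_ ?_ ?_ h_one_sub
  · rwa [inv_sqrt_mul_self hY]
  · rwa [inv_sqrt_mul_self hY]
  · rw [inv_sqrt_mul_self hY, inv_sqrt_mul_self hX]
    exact inv_le_inv_of_posDef hY hYX

theorem invSqrtConj_le_smul_invSqrtConj_of_smul_le (hα : α.IsHermitian) (hτ : ‖α - 1‖ ≤ τ)
    (hτ' : τ ≤ 1 / 2) (hc : 0 < c) (hd : 0 < d) (hY : Y.PosDef) (hcY : c • 1 ≤ Y)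
    (hYd : Y ≤ d • 1) {s m : ℝ} (hs : 0 ≤ s) (hm : 0 < m) (hmX : m • Y ≤ X)
    (hXm : X ≤ (Real.exp (2 * s) * m) • Y) :
    invSqrtConj X α ≤ ((1 + 4 * (d / c) * τ * s) * m⁻¹) • invSqrtConj Y α := by
  have h := invSqrtConj_le_smul_invSqrtConj (c := m * c) (d := m * d) hα hτ hτ' (mul_pos hm hc)
    (mul_pos hm hd) (hY.smul hm) (by rw [mul_smul]; exact smul_le_smul_of_nonneg_left hcY hm.le)
    (by rw [mul_smul]; exact smul_le_smul_of_nonneg_left hYd hm.le) hs hmX (by rwa [smul_smul])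
  rwa [mul_div_mul_left _ _ hm.ne', invSqrtConj_smul_left hm hY, smul_smul] at h

theorem posDef_of_norm_sub_one_le (hα : α.IsHermitian) (hτ : ‖α - 1‖ ≤ τ) (hτ' : τ < 1) :
    α.PosDef :=
  posDef_of_le (PosDef.one.smul (sub_pos.2 hτ')) (one_sub_smul_one_le hα.isSelfAdjoint hτ)

variable [NeZero n]

theorem hilbertDist_D_le (hα : α.IsHermitian) (hτ : ‖α - 1‖ ≤ τ) (hτ' : τ ≤ 1 / 2)
    (hc : 0 < c) (hd : 0 < d) (hcX : c • 1 ≤ X) (hXd : X ≤ d • 1) (hcY : c • 1 ≤ Y)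
    (hYd : Y ≤ d • 1) :
    hilbertDist (D α X) (D α Y) ≤ (1 + 4 * (d / c) * τ) * hilbertDist X Y := by
  have hX : X.PosDef := posDef_of_le (PosDef.one.smul hc) hcX
  have hY : Y.PosDef := posDef_of_le (PosDef.one.smul hc) hcY
  have hα_pos := posDef_of_norm_sub_one_le hα hτ (by linarith)
  obtain ⟨m, hm, hmX, hXm⟩ := (hilbertDist_le_iff hX hY).1 le_rfl
  have hδ := hilbertDist_nonneg hX hY
  set δ := hilbertDist X Y
  have hτ₀ : 0 ≤ τ := (norm_nonneg _).trans hτ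
  have hm' : 0 < Real.exp δ * m := mul_pos (Real.exp_pos δ) hm
  have h_two : 2 * (δ / 2) = δ := mul_div_cancel₀ δ two_ne_zero
  have h_upper := invSqrtConj_le_smul_invSqrtConj_of_smul_le hα hτ hτ' hc hd hY hcY hYd
    (s := δ / 2) (by positivity) hm hmX (by rwa [h_two])
  have h_lower := invSqrtConj_le_smul_invSqrtConj_of_smul_le (s := δ / 2) (X := Y)
    (m := (Real.exp δ * m)⁻¹) hα hτ hτ' hc hd hX hcX hXd (by positivity) (inv_pos.2 hm')
    ((inv_smul_le_iff_of_pos hm').2 hXm) (by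
      rw [h_two, mul_inv, mul_inv_cancel_left₀ (Real.exp_pos δ).ne']
      exact (le_inv_smul_iff_of_pos hm).2 hmX)
  set ρ := 1 + 4 * (d / c) * τ * (δ / 2) with hρ
  have hρ₀ : 0 < ρ := by positivity
  rw [inv_inv, ← inv_smul_le_iff_of_pos (mul_pos hρ₀ hm')] at h_lower
  rw [hilbertDist_D_D hα_pos hα_pos hX hY]
  refine hilbertDist_le_of_le_of_le (posDef_invSqrtConj hX hα_pos) (posDef_invSqrtConj hY hα_pos)
    (by positivity) h_lower h_upper ?_
  have h_exp : ρ ≤ Real.exp (4 * (d / c) * τ * (δ / 2)) := by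
    rw [hρ, add_comm]
    exact Real.add_one_le_exp _
  calc ρ * m⁻¹ = ρ * ρ * Real.exp δ * (ρ * (Real.exp δ * m))⁻¹ := by field_simp
    _ ≤ Real.exp (4 * (d / c) * τ * (δ / 2)) * Real.exp (4 * (d / c) * τ * (δ / 2)) *
          Real.exp δ * (ρ * (Real.exp δ * m))⁻¹ := by gcongr
    _ = Real.exp ((1 + 4 * (d / c) * τ) * δ) * (ρ * (Real.exp δ * m))⁻¹ := by
      rw [← Real.exp_add, ← Real.exp_add]
      ring_nf

theorem hilbertDist_D_D_one_le (hα : α.IsHermitian) (hτ : ‖α - 1‖ ≤ τ) (hτ' : τ ≤ 1 / 2)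
    (hX : X.PosDef) : hilbertDist (D α X) (D 1 X) ≤ 4 * τ := by
  have hτ₀ : 0 ≤ τ := (norm_nonneg _).trans hτ
  have hα_pos := posDef_of_norm_sub_one_le hα hτ (by linarith)
  have h_lower := (invSqrtConj_le_invSqrtConj_iff hX).2 (one_sub_smul_one_le hα.isSelfAdjoint hτ)
  have h_upper := (invSqrtConj_le_invSqrtConj_iff hX).2 (le_one_add_smul_one hα.isSelfAdjoint hτ)
  rw [invSqrtConj_smul_right] at h_lower h_upper
  rw [hilbertDist_D_D hα_pos .one hX hX]
  refine hilbertDist_le_of_le_of_le (posDef_invSqrtConj hX hα_pos) (posDef_invSqrtConj hX .one)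
    (by linarith) h_lower h_upper ?_
  nlinarith [Real.add_one_le_exp (4 * τ)]

end NearIdentity

section HilbertDensity

variable {n : ℕ} {X Y : Matrix (Fin n) (Fin n) ℂ}

/-- The positive definite density matrices as a metric space for the Hilbert metric. This is a
structure rather than a subtype so that it does not inherit the topology of the matrices. -/
@[ext]
structure HilbertDensity (n : ℕ) where
  toMatrix : Matrix (Fin n) (Fin n) ℂ
  mem_densityPD : toMatrix ∈ densityPD n

variable [NeZero n]

theorem le_exp_hilbertDist_smul (hX : X ∈ densityPD n) (hY : Y ∈ densityPD n) :
    X ≤ Real.exp (hilbertDist X Y) • Y := by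
  obtain ⟨m, -, hmX, hXm⟩ := (hilbertDist_le_iff hX.1 hY.1).1 le_rfl
  have hm : m ≤ 1 := by
    simpa only [trace_smul, hX.2, hY.2, Complex.smul_re, Complex.one_re, smul_eq_mul, mul_one]
      using re_trace_mono hmX
  exact hXm.trans (smul_le_smul_of_nonneg_right
    (mul_le_of_le_one_right (Real.exp_pos _).le hm) hY.1.posSemidef.nonneg)

theorem eq_of_hilbertDist_eq_zero (hX : X ∈ densityPD n) (hY : Y ∈ densityPD n)
    (h : hilbertDist X Y = 0) : X = Y := by
  have h_le := le_exp_hilbertDist_smul hX hY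
  have h_ge := le_exp_hilbertDist_smul hY hX
  rw [hilbertDist_comm hY.1 hX.1] at h_ge
  rw [h, Real.exp_zero, one_smul] at h_le h_ge
  exact h_le.antisymm h_ge

open scoped Matrix.Norms.L2Operator in
theorem norm_sub_le_exp_hilbertDist (hX : X ∈ densityPD n) (hY : Y ∈ densityPD n) :
    ‖X - Y‖ ≤ 3 * (Real.exp (hilbertDist X Y) - 1) := by
  have h_le := le_exp_hilbertDist_smul hX hY
  have h_ge := le_exp_hilbertDist_smul hY hX
  rw [hilbertDist_comm hY.1 hX.1] at h_ge
  have h_exp := sub_nonneg.2 (Real.one_le_exp (hilbertDist_nonneg hX.1 hY.1))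
  set e := Real.exp (hilbertDist X Y)
  have hX₁ := norm_le_one_of_mem_density (densityPD_subset_density hX)
  have hY₁ := norm_le_one_of_mem_density (densityPD_subset_density hY)
  have h_gap : ‖e • Y - X‖ ≤ ‖(e - 1) • (X + Y)‖ := by
    refine CStarAlgebra.norm_le_norm_of_nonneg_of_le (sub_nonneg.2 h_le) ?_
    rw [← sub_nonneg] at h_ge ⊢
    convert h_ge using 1
    module
  calc ‖X - Y‖ = ‖(e - 1) • Y - (e • Y - X)‖ := by congr 1; module
    _ ≤ ‖(e - 1) • Y‖ + ‖(e - 1) • (X + Y)‖ := (norm_sub_le _ _).trans (by gcongr)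
    _ ≤ (e - 1) * 1 + (e - 1) * (1 + 1) := by
      rw [norm_smul_of_nonneg h_exp, norm_smul_of_nonneg h_exp]
      gcongr
      exact (norm_add_le _ _).trans (add_le_add hX₁ hY₁)
    _ = 3 * (e - 1) := by ring

open scoped Matrix.Norms.L2Operator in
theorem mem_densityPD_and_hilbertDist_le_of_tendsto {F : Matrix (Fin n) (Fin n) ℂ}
    {u : ℕ → Matrix (Fin n) (Fin n) ℂ} {ε : ℝ} (hX : X ∈ densityPD n) (hu : ∀ j, u j ∈ densityPD n)
    (h_lim : Tendsto u atTop (𝓝 F)) (hε : ∀ᶠ j in atTop, hilbertDist X (u j) ≤ ε) :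
    F ∈ densityPD n ∧ hilbertDist X F ≤ 2 * ε := by
  have h_upper : X ≤ Real.exp ε • F := by
    refine ge_of_tendsto (h_lim.const_smul (Real.exp ε)) (hε.mono fun j hj => ?_)
    exact (le_exp_hilbertDist_smul hX (hu j)).trans
      (smul_le_smul_of_nonneg_right (Real.exp_le_exp.2 hj) (hu j).1.posSemidef.nonneg)
  have h_lower : F ≤ Real.exp ε • X := by
    refine le_of_tendsto h_lim (hε.mono fun j hj => ?_)
    rw [hilbertDist_comm hX.1 (hu j).1] at hj
    exact (le_exp_hilbertDist_smul (hu j) hX).trans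
      (smul_le_smul_of_nonneg_right (Real.exp_le_exp.2 hj) hX.1.posSemidef.nonneg)
  have h_trace : F.trace = 1 := tendsto_nhds_unique
    ((continuous_id.matrix_trace.tendsto F).comp h_lim)
    (tendsto_const_nhds.congr fun j => (hu j).2.symm)
  have hF : F.PosDef := posDef_of_le (hX.1.smul (inv_pos.2 (Real.exp_pos ε)))
    ((inv_smul_le_iff_of_pos (Real.exp_pos ε)).2 h_upper)
  refine ⟨⟨hF, h_trace⟩, hilbertDist_le_of_le_of_le hX.1 hF (inv_pos.2 (Real.exp_pos ε))
    ((inv_smul_le_iff_of_pos (Real.exp_pos ε)).2 h_lower) h_upper ?_⟩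
  rw [← Real.exp_neg, ← Real.exp_add]
  ring_nf
  rfl

namespace HilbertDensity

instance : MetricSpace (HilbertDensity n) where
  dist X Y := hilbertDist X.toMatrix Y.toMatrix
  dist_self X := by
    refine le_antisymm ((hilbertDist_le_iff X.mem_densityPD.1 X.mem_densityPD.1).2
      ⟨1, one_pos, ?_⟩) (hilbertDist_nonneg X.mem_densityPD.1 X.mem_densityPD.1)
    simp
  dist_comm X Y := hilbertDist_comm X.mem_densityPD.1 Y.mem_densityPD.1
  dist_triangle X Y Z :=
    hilbertDist_triangle X.mem_densityPD.1 Y.mem_densityPD.1 Z.mem_densityPD.1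
  eq_of_dist_eq_zero {X Y} h :=
    HilbertDensity.ext (eq_of_hilbertDist_eq_zero X.mem_densityPD Y.mem_densityPD h)

theorem dist_def (X Y : HilbertDensity n) : dist X Y = hilbertDist X.toMatrix Y.toMatrix := rfl

instance : Nonempty (HilbertDensity n) := ⟨⟨unif n, unif_mem_densityPD⟩⟩

open scoped Matrix.Norms.L2Operator in
theorem uniformContinuous_toMatrix :
    UniformContinuous (toMatrix : HilbertDensity n → Matrix (Fin n) (Fin n) ℂ) := by
  have h_cont : ContinuousAt (fun d : ℝ => 3 * (Real.exp d - 1)) 0 := by fun_prop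
  refine Metric.uniformContinuous_iff.2 fun ε hε => ?_
  obtain ⟨δ, hδ, h⟩ := Metric.eventually_nhds_iff.1
    (h_cont.eventually_lt_const (u := ε) (by simpa using hε))
  refine ⟨δ, hδ, fun X Y hXY => ?_⟩
  rw [dist_eq_norm]
  exact (norm_sub_le_exp_hilbertDist X.mem_densityPD Y.mem_densityPD).trans_lt
    (h (by rwa [← dist_def, dist_zero_right, Real.norm_of_nonneg dist_nonneg]))

theorem continuous_toMatrix :
    Continuous (toMatrix : HilbertDensity n → Matrix (Fin n) (Fin n) ℂ) :=
  uniformContinuous_toMatrix.continuous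

open scoped Matrix.Norms.L2Operator in
instance : CompleteSpace (HilbertDensity n) := by
  have : CompleteSpace (Matrix (Fin n) (Fin n) ℂ) := FiniteDimensional.complete ℂ _
  refine Metric.complete_of_cauchySeq_tendsto fun u hu => ?_
  obtain ⟨F, hF⟩ := cauchySeq_tendsto_of_complete (uniformContinuous_toMatrix.comp_cauchySeq hu)
  have h_dist (ε : ℝ) (hε : 0 < ε) :
      ∃ N, ∀ m ≥ N, F ∈ densityPD n ∧ hilbertDist (u m).toMatrix F ≤ 2 * ε := by
    obtain ⟨N, hN⟩ := Metric.cauchySeq_iff.1 hu ε hε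
    exact ⟨N, fun m hm => mem_densityPD_and_hilbertDist_le_of_tendsto (u m).mem_densityPD
      (fun j => (u j).mem_densityPD) hF
      ((eventually_ge_atTop N).mono fun j hj => (hN m hm j hj).le)⟩
  obtain ⟨N, hN⟩ := h_dist 1 one_pos
  refine ⟨⟨F, (hN N le_rfl).1⟩, Metric.tendsto_atTop.2 fun ε hε => ?_⟩
  obtain ⟨N, hN⟩ := h_dist (ε / 3) (by linarith)
  exact ⟨N, fun m hm => (hN m hm).2.trans_lt (by linarith)⟩

end HilbertDensity

variable {T : Matrix (Fin n) (Fin n) ℂ → Matrix (Fin n) (Fin n) ℂ} {q : ℝ}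

theorem exists_fixedPoint_of_hilbertDist_le (hq₀ : 0 ≤ q) (hq₁ : q < 1)
    (hT : Set.MapsTo T (density n) (densityPD n))
    (h : ∀ X ∈ densityPD n, ∀ Y ∈ densityPD n, hilbertDist (T X) (T Y) ≤ q * hilbertDist X Y) :
    ∃ F ∈ densityPD n, T F = F ∧ (∀ X ∈ density n, T X = X → X = F) ∧
      (∀ X ∈ density n, Tendsto (fun m => T^[m] X) atTop (𝓝 F)) ∧
      ∀ X ∈ densityPD n, hilbertDist F X ≤ hilbertDist (T X) X / (1 - q) := by
  let S (X : HilbertDensity n) : HilbertDensity n :=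
    ⟨T X.toMatrix, hT (densityPD_subset_density X.mem_densityPD)⟩
  have hS : ContractingWith ⟨q, hq₀⟩ S := ⟨hq₁, LipschitzWith.of_dist_le_mul fun X Y =>
    h X.toMatrix X.mem_densityPD Y.toMatrix Y.mem_densityPD⟩
  have h_iterate (X : HilbertDensity n) (m : ℕ) : (S^[m] X).toMatrix = T^[m] X.toMatrix :=
    Function.Semiconj.iterate_right (f := HilbertDensity.toMatrix) (fun _ => rfl) m X
  set F := ContractingWith.fixedPoint S hS
  have h_fixed : S F = F := hS.fixedPoint_isFixedPt
  refine ⟨F.toMatrix, F.mem_densityPD, congrArg HilbertDensity.toMatrix h_fixed,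
    fun X hX hTX => ?_, fun X hX => ?_, fun X hX => ?_⟩
  · exact congrArg HilbertDensity.toMatrix
      (hS.fixedPoint_unique (x := ⟨X, hTX ▸ hT hX⟩) (HilbertDensity.ext hTX))
  · rw [← tendsto_add_atTop_iff_nat 1]
    simpa only [Function.comp_def, h_iterate, Function.iterate_succ_apply] using
      (HilbertDensity.continuous_toMatrix.tendsto F).comp
        (hS.tendsto_iterate_fixedPoint ⟨T X, hT hX⟩)
  · have h_dist := hS.dist_fixedPoint_le ⟨X, hX⟩
    rwa [dist_comm, dist_comm _ (S _)] at h_dist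

end HilbertDensity

section Topology

/-- The affine space of Hermitian matrices of trace one, in which `frobBall` is a ball. -/
def hermitianTraceOne (n : ℕ) : Set (Matrix (Fin n) (Fin n) ℂ) :=
  {X | X.IsHermitian ∧ X.trace = 1}

variable {n : ℕ} {F : Matrix (Fin n) (Fin n) ℂ} {s : Set (Matrix (Fin n) (Fin n) ℂ)}

open scoped Matrix.Norms.Frobenius in
theorem exists_frobBall_subset (hs : s ∈ 𝓝[hermitianTraceOne n] F) :
    ∃ ε > 0, frobBall F ε ⊆ s := by
  obtain ⟨ε, hε, h⟩ := Metric.mem_nhdsWithin_iff.1 hs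
  exact ⟨ε, hε, fun X hX => h ⟨mem_ball_iff_norm.2 hX.2.2, hX.1, hX.2.1⟩⟩

open scoped Matrix.Norms.Frobenius in
theorem frobBall_mem_nhdsWithin {ε : ℝ} (hε : 0 < ε) :
    frobBall F ε ∈ 𝓝[hermitianTraceOne n] F :=
  Metric.mem_nhdsWithin_iff.2 ⟨ε, hε, fun _ hX => ⟨hX.2.1, hX.2.2, mem_ball_iff_norm.1 hX.1⟩⟩

theorem affineSpan_density_subset :
    (affineSpan ℝ (density n) : Set (Matrix (Fin n) (Fin n) ℂ)) ⊆ hermitianTraceOne n := by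
  refine fun X hX => affineSpan_induction (p := (· ∈ hermitianTraceOne n)) hX
    (fun X hX => ⟨hX.1.1, hX.2⟩) fun c X Y Z hX hY hZ => ?_
  rw [vsub_eq_sub, vadd_eq_add]
  refine ⟨((hX.1.sub hY.1).smul (.all c)).add hZ.1, ?_⟩
  rw [trace_add, trace_smul, trace_sub, hX.2, hY.2, hZ.2, sub_self, smul_zero, zero_add]

variable [NeZero n]

theorem densityPD_mem_nhdsWithin (hF : F ∈ densityPD n) :
    densityPD n ∈ 𝓝[hermitianTraceOne n] F := by
  filter_upwards [nhdsWithin_mono F (fun X hX => hX.1) (eventually_posDef hF.1),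
    self_mem_nhdsWithin] with X hX hX₁ using ⟨hX, hX₁.2⟩

theorem densityPD_subset_intrinsicInterior :
    densityPD n ⊆ intrinsicInterior ℝ (density n) := fun F hF =>
  mem_intrinsicInterior.2 ⟨⟨F, subset_affineSpan ℝ _ (densityPD_subset_density hF)⟩,
    mem_interior_iff_mem_nhds.2 <| preimage_coe_mem_nhds_subtype.2 <|
      nhdsWithin_mono F affineSpan_density_subset <|
        mem_of_superset (densityPD_mem_nhdsWithin hF) densityPD_subset_density, rfl⟩

theorem exists_forall_hilbertDist_lt_imp_mem (hF : F ∈ densityPD n)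
    (hs : s ∈ 𝓝[hermitianTraceOne n] F) :
    ∃ δ > 0, ∀ X ∈ densityPD n, hilbertDist X F < δ → X ∈ s := by
  have h_tendsto : Tendsto HilbertDensity.toMatrix (𝓝 ⟨F, hF⟩) (𝓝[hermitianTraceOne n] F) :=
    tendsto_nhdsWithin_iff.2 ⟨HilbertDensity.continuous_toMatrix.tendsto ⟨F, hF⟩,
      .of_forall fun X => ⟨X.mem_densityPD.1.isHermitian, X.mem_densityPD.2⟩⟩
  obtain ⟨δ, hδ, h⟩ := Metric.eventually_nhds_iff.1 (h_tendsto hs)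
  exact ⟨δ, hδ, fun X hX hXF => h (y := ⟨X, hX⟩) hXF⟩

end Topology

section PhiTheta

open scoped Matrix.Norms.L2Operator

theorem IsTraceBounded.hilbertDist_D_map_le {n m : ℕ} [NeZero n] [NeZero m] {a b τ : ℝ}
    {L : Matrix (Fin n) (Fin n) ℂ →ₗ[ℝ] Matrix (Fin m) (Fin m) ℂ} (hL : IsTraceBounded a b L)
    (ha : 0 < a) (hab : a ≤ b) {α : Matrix (Fin m) (Fin m) ℂ} (hα : α.IsHermitian)
    (hτ : ‖α - 1‖ ≤ τ) (hτ' : τ ≤ 1 / 2) {X Y : Matrix (Fin n) (Fin n) ℂ}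
    (hX : X ∈ densityPD n) (hY : Y ∈ densityPD n) :
    hilbertDist (D α (L X)) (D α (L Y)) ≤
      (1 + 4 * (b / a) * τ) * ((b - a) / (b + a)) * hilbertDist X Y := by
  have hb : 0 < b := ha.trans_le hab
  have hτ₀ : 0 ≤ τ := (norm_nonneg _).trans hτ
  have h_bounds (Z) (hZ : Z ∈ densityPD n) : a • 1 ≤ L Z ∧ L Z ≤ b • 1 := by
    simpa only [hZ.2, Complex.one_re, mul_one] using hL Z hZ.1.posSemidef.nonneg
  rw [mul_assoc]
  exact (hilbertDist_D_le hα hτ hτ' ha hb (h_bounds X hX).1 (h_bounds X hX).2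
    (h_bounds Y hY).1 (h_bounds Y hY).2).trans
    (mul_le_mul_of_nonneg_left (hL.hilbertDist_le ha hab hX.1 hY.1) (by positivity))

variable {n k : ℕ} [NeZero n] {A : Fin k → Matrix (Fin n) (Fin n) ℂ}
  {α β X Y : Matrix (Fin n) (Fin n) ℂ} {r τ : ℝ}

theorem mapsTo_Phi (hA : IsPositive A) (hα : α.PosDef) (hβ : β.PosDef) :
    Set.MapsTo (Phi A α β) (density n) (densityPD n) := fun X hX =>
  D_mem_densityPD hα (Qtilde_mem_densityPD hA (D_mem_densityPD hβ (hA X hX)).1).1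

theorem Phi_smul_smul (hA : IsPositive A) (hr : r ≠ 0) (hβ : β.PosDef) (hX : X ∈ density n) :
    Phi A (r • α) (r • β) X = Phi A α β X := by
  simp only [Phi, Function.comp_apply]
  rw [D_smul_left (hA X hX) hr,
    D_smul_left (Qtilde_mem_densityPD hA (D_mem_densityPD hβ (hA X hX)).1).1 hr]

theorem Theta_eq_Phi_one_one (hA : IsPositive A) (hX : X ∈ density n) :
    Theta A X = Phi A 1 1 X := by
  rw [Theta, unif_eq_smul_one, Phi_smul_smul hA (inv_ne_zero (NeZero.ne _)) .one hX]

theorem Phi_eq_D_Qdual (hA : IsPositive A) (hβ : β.PosDef) (hX : X ∈ density n) :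
    Phi A α β X = D α (Qdual A (D β (Q A X))) :=
  D_traceNormalize (posDef_Qdual hA (D_mem_densityPD hβ (hA X hX)).1) α

theorem hilbertDist_Phi_le (hA : IsPositive A) (hα : α.IsHermitian) (hβ : β.IsHermitian)
    (hατ : ‖α - 1‖ ≤ τ) (hβτ : ‖β - 1‖ ≤ τ) (hτ : τ ≤ 1 / 2) (hX : X ∈ densityPD n)
    (hY : Y ∈ densityPD n) :
    hilbertDist (Phi A α β X) (Phi A α β Y) ≤
      ((1 + 4 * (bConst A / aConst A) * τ) * kappa A) ^ 2 * hilbertDist X Y := by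
  have ha := aConst_pos hA
  have hab := aConst_le_bConst hA
  have hb : 0 < bConst A := ha.trans_le hab
  have hτ₀ : 0 ≤ τ := (norm_nonneg _).trans hατ
  have hκ := kappa_nonneg hA
  have hβ_pos := posDef_of_norm_sub_one_le hβ hβτ (by linarith)
  have h_mem {Z} (hZ : Z ∈ densityPD n) : D β (Q A Z) ∈ densityPD n :=
    D_mem_densityPD hβ_pos (posDef_Q hA hZ.1)
  rw [Phi_eq_D_Qdual hA hβ_pos (densityPD_subset_density hX),
    Phi_eq_D_Qdual hA hβ_pos (densityPD_subset_density hY)]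
  set c := (1 + 4 * (bConst A / aConst A) * τ) * kappa A
  calc hilbertDist (D α (Qdual A (D β (Q A X)))) (D α (Qdual A (D β (Q A Y))))
      ≤ c * hilbertDist (D β (Q A X)) (D β (Q A Y)) :=
        (isTraceBounded_Qdual hA).hilbertDist_D_map_le ha hab hα hατ hτ (h_mem hX) (h_mem hY)
    _ ≤ c * (c * hilbertDist X Y) := mul_le_mul_of_nonneg_left
        ((isTraceBounded_Q hA).hilbertDist_D_map_le ha hab hβ hβτ hτ hX hY) (by positivity)
    _ = c ^ 2 * hilbertDist X Y := by ring

theorem hilbertDist_Theta_le (hA : IsPositive A) (hX : X ∈ densityPD n) (hY : Y ∈ densityPD n) :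
    hilbertDist (Theta A X) (Theta A Y) ≤ kappa A ^ 2 * hilbertDist X Y := by
  have h_one : ‖(1 : Matrix (Fin n) (Fin n) ℂ) - 1‖ ≤ 0 := by rw [sub_self, norm_zero]
  simpa only [Theta_eq_Phi_one_one hA (densityPD_subset_density hX),
    Theta_eq_Phi_one_one hA (densityPD_subset_density hY), mul_zero, add_zero, one_mul] using
    hilbertDist_Phi_le hA isHermitian_one isHermitian_one h_one h_one one_half_pos.le hX hY

theorem hilbertDist_Phi_Theta_le (hA : IsPositive A) (hα : α.IsHermitian) (hβ : β.IsHermitian)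
    (hατ : ‖α - 1‖ ≤ τ) (hβτ : ‖β - 1‖ ≤ τ) (hτ : τ ≤ 1 / 2) (hX : X ∈ density n) :
    hilbertDist (Phi A α β X) (Theta A X) ≤ 8 * τ := by
  have hα_pos := posDef_of_norm_sub_one_le hα hατ (by linarith)
  have hβ_pos := posDef_of_norm_sub_one_le hβ hβτ (by linarith)
  have hQX := hA X hX
  have hDβ := (D_mem_densityPD hβ_pos hQX).1
  have hD₁ := (D_mem_densityPD .one hQX).1
  have hRβ := (Qtilde_mem_densityPD hA hDβ).1
  have hR₁ := (Qtilde_mem_densityPD hA hD₁).1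
  rw [Theta_eq_Phi_one_one hA hX]
  calc hilbertDist (D α (Qtilde A (D β (Q A X)))) (D 1 (Qtilde A (D 1 (Q A X))))
      ≤ hilbertDist (D α (Qtilde A (D β (Q A X)))) (D 1 (Qtilde A (D β (Q A X)))) +
          hilbertDist (D 1 (Qtilde A (D β (Q A X)))) (D 1 (Qtilde A (D 1 (Q A X)))) :=
        hilbertDist_triangle (D_mem_densityPD hα_pos hRβ).1 (D_mem_densityPD .one hRβ).1
          (D_mem_densityPD .one hR₁).1
    _ ≤ 4 * τ + kappa A * hilbertDist (D β (Q A X)) (D 1 (Q A X)) := by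
        rw [hilbertDist_D_one hRβ hR₁]
        exact add_le_add (hilbertDist_D_D_one_le hα hατ hτ hRβ) (hilbertDist_Qtilde_le hA hDβ hD₁)
    _ ≤ 4 * τ + 1 * (4 * τ) := by
        gcongr
        · exact hilbertDist_nonneg hDβ hD₁
        · exact (kappa_lt_one hA).le
        · exact hilbertDist_D_D_one_le hβ hβτ hτ hQX
    _ = 8 * τ := by ring

theorem exists_contraction_radius {κ : ℝ} (hκ₀ : 0 ≤ κ) (hκ₁ : κ < 1) (C : ℝ) {δ : ℝ}
    (hδ : 0 < δ) : ∃ τ > 0, τ ≤ 1 / 2 ∧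
      ∃ q, 0 ≤ q ∧ q < 1 ∧ ((1 + C * τ) * κ) ^ 2 ≤ q ∧ 8 * τ / (1 - q) < δ := by
  obtain ⟨q, hκq, hq⟩ := exists_between (pow_lt_one₀ hκ₀ hκ₁ two_ne_zero)
  have h_factor : ContinuousAt (fun τ : ℝ => ((1 + C * τ) * κ) ^ 2) 0 := by fun_prop
  have h_move : ContinuousAt (fun τ : ℝ => 8 * τ / (1 - q)) 0 := by fun_prop
  have h_small := (h_factor.eventually_lt_const (u := q) (by simpa using hκq)).and <|
    (h_move.eventually_lt_const (u := δ) (by simpa using hδ)).and <|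
      eventually_le_nhds (one_half_pos (α := ℝ))
  obtain ⟨τ, ⟨hτq, hτδ, hτ⟩, hτ₀⟩ :=
    ((h_small.filter_mono nhdsWithin_le_nhds).and (self_mem_nhdsWithin (s := Set.Ioi 0))).exists
  exact ⟨τ, hτ₀, hτ, q, (sq_nonneg κ).trans hκq.le, hq, hτq.le, hτδ⟩

theorem eventually_norm_smul_sub_one_lt (hτ : 0 < τ) :
    ∀ᶠ α in 𝓝 (unif n), ‖(n : ℝ) • α - 1‖ < τ := by
  have h_cont : Continuous fun α : Matrix (Fin n) (Fin n) ℂ => ‖(n : ℝ) • α - 1‖ := by fun_prop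
  have h_unif : ‖(n : ℝ) • unif n - 1‖ < τ := by
    rwa [unif_eq_smul_one, smul_inv_smul₀ (NeZero.ne _), sub_self, norm_zero]
  exact h_cont.continuousAt.eventually_lt_const h_unif

theorem exists_frobBall_unif_forall_fixedPoint {F : Matrix (Fin n) (Fin n) ℂ} (hA : IsPositive A)
    (hF : F ∈ densityPD n) (h_fixed : Theta A F = F) {s : Set (Matrix (Fin n) (Fin n) ℂ)}
    (hs : s ∈ 𝓝[hermitianTraceOne n] F) :
    ∃ ε > 0, frobBall (unif n) ε ⊆ densityPD n ∧
      ∀ α ∈ frobBall (unif n) ε, ∀ β ∈ frobBall (unif n) ε, ∃ U ∈ s, Phi A α β U = U ∧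
        (∀ V ∈ density n, Phi A α β V = V → V = U) ∧
        ∀ X ∈ density n, Tendsto (fun m => (Phi A α β)^[m] X) atTop (𝓝 U) := by
  obtain ⟨δ, hδ, h_near⟩ := exists_forall_hilbertDist_lt_imp_mem hF hs
  obtain ⟨τ, hτ₀, hτ, q, hq₀, hq₁, hτq, hτδ⟩ := exists_contraction_radius (kappa_nonneg hA)
    (kappa_lt_one hA) (4 * (bConst A / aConst A)) hδ
  obtain ⟨ε, hε, h_ball⟩ := exists_frobBall_subset (inter_mem
    (densityPD_mem_nhdsWithin unif_mem_densityPD)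
    (mem_nhdsWithin_of_mem_nhds (eventually_norm_smul_sub_one_lt (n := n) hτ₀)))
  refine ⟨ε, hε, fun α hα => (h_ball hα).1, fun α hα β hβ => ?_⟩
  obtain ⟨⟨hα_pos, -⟩, hατ⟩ := h_ball hα
  obtain ⟨⟨hβ_pos, -⟩, hβτ⟩ := h_ball hβ
  have hnα := hα_pos.isHermitian.smul (.all (n : ℝ))
  have hnβ := hβ_pos.isHermitian.smul (.all (n : ℝ))
  have h_scale {X} (hX : X ∈ densityPD n) :
      Phi A α β X = Phi A ((n : ℝ) • α) ((n : ℝ) • β) X :=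
    (Phi_smul_smul hA (NeZero.ne _) hβ_pos (densityPD_subset_density hX)).symm
  obtain ⟨U, hU, hUΦ, h_unique, h_tendsto, h_dist⟩ := exists_fixedPoint_of_hilbertDist_le hq₀ hq₁
    (mapsTo_Phi hA hα_pos hβ_pos) fun X hX Y hY => by
      rw [h_scale hX, h_scale hY]
      exact (hilbertDist_Phi_le hA hnα hnβ hατ.le hβτ.le hτ hX hY).trans
        (mul_le_mul_of_nonneg_right hτq (hilbertDist_nonneg hX.1 hY.1))
  have h_move := hilbertDist_Phi_Theta_le hA hnα hnβ hατ.le hβτ.le hτ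
    (densityPD_subset_density hF)
  rw [← h_scale hF, h_fixed] at h_move
  have hUF : hilbertDist U F < δ := (h_dist F hF).trans_lt
    ((div_le_div_of_nonneg_right h_move (sub_nonneg.2 hq₁.le)).trans_lt hτδ)
  exact ⟨U, h_near U hU hUF, hUΦ, h_unique, h_tendsto⟩

theorem exists_fixedPoint_Theta (hA : IsPositive A) :
    ∃ F ∈ densityPD n, Theta A F = F ∧ (∀ X ∈ density n, Theta A X = X → X = F) ∧
      ∀ X ∈ density n, Tendsto (fun m => (Theta A)^[m] X) atTop (𝓝 F) := by
  obtain ⟨F, hF, h_fixed, h_unique, h_tendsto, -⟩ := exists_fixedPoint_of_hilbertDist_le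
    (sq_nonneg (kappa A)) (pow_lt_one₀ (kappa_nonneg hA) (kappa_lt_one hA) two_ne_zero)
    (mapsTo_Phi hA unif_mem_densityPD.1 unif_mem_densityPD.1)
    fun X hX Y hY => hilbertDist_Theta_le hA hX hY
  exact ⟨F, hF, h_fixed, h_unique, h_tendsto⟩

end PhiTheta

end

end QBridge

open QBridge in
theorem theorem5p1_general (n k : ℕ) (hn : 0 < n) (A : Fin k → Matrix (Fin n) (Fin n) ℂ)
    (hpos : IsPositive A) :
    ((0 ≤ kappa A ∧ kappa A < 1) ∧
      ∀ X Y : Matrix (Fin n) (Fin n) ℂ, X.PosDef → Y.PosDef →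
        (Q A X).PosDef ∧ (Qtilde A X).PosDef ∧
        hilbertDist (Q A X) (Q A Y) ≤ kappa A * hilbertDist X Y ∧
        hilbertDist (Qtilde A X) (Qtilde A Y) ≤ kappa A * hilbertDist X Y) ∧
    (∀ t : ℝ, 0 < t → ∀ X Y : Matrix (Fin n) (Fin n) ℂ, X.PosDef → Y.PosDef →
        (D ((t : ℂ) • 1) X).PosDef ∧
        hilbertDist (D ((t : ℂ) • 1) X) (D ((t : ℂ) • 1) Y) = hilbertDist X Y) ∧
    (Set.MapsTo (Theta A) (densityPD n) (densityPD n) ∧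
      ∀ X ∈ densityPD n, ∀ Y ∈ densityPD n,
        hilbertDist (Theta A X) (Theta A Y) ≤ kappa A ^ 2 * hilbertDist X Y) ∧
    ∃ F : Matrix (Fin n) (Fin n) ℂ,
      (F ∈ densityPD n ∧ F ∈ intrinsicInterior ℝ (density n) ∧ Theta A F = F ∧
        (∀ X ∈ density n, Theta A X = X → X = F) ∧
        ∀ X ∈ density n,
          Filter.Tendsto (fun m : ℕ => (Theta A)^[m] X) Filter.atTop (nhds F)) ∧
      ∃ ε₁ > 0, ∃ ε₂ > 0,
        frobBall (unif n) ε₁ ⊆ densityPD n ∧ frobBall F ε₂ ⊆ densityPD n ∧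
        ∀ α ∈ frobBall (unif n) ε₁, ∀ β ∈ frobBall (unif n) ε₁,
          ∃ U ∈ frobBall F ε₂, Phi A α β U = U ∧
            (∀ V ∈ density n, Phi A α β V = V → V = U) ∧
            ∀ X ∈ density n,
              Filter.Tendsto (fun m : ℕ => (Phi A α β)^[m] X) Filter.atTop (nhds U) := by
  have : NeZero n := ⟨hn.ne'⟩
  obtain ⟨F, hF, hF_theta⟩ := exists_fixedPoint_Theta hpos
  obtain ⟨ε₂, hε₂, h_ball_F⟩ := exists_frobBall_subset (densityPD_mem_nhdsWithin hF)
  obtain ⟨ε₁, hε₁, h_ball_unif, h_Phi⟩ :=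
    exists_frobBall_unif_forall_fixedPoint hpos hF hF_theta.1 (frobBall_mem_nhdsWithin hε₂)
  refine ⟨⟨⟨kappa_nonneg hpos, kappa_lt_one hpos⟩, fun X Y hX hY => ⟨posDef_Q hpos hX,
      (Qtilde_mem_densityPD hpos hX).1, hilbertDist_Q_le hpos hX hY,
      hilbertDist_Qtilde_le hpos hX hY⟩⟩,
    fun t ht X Y hX hY => ?_,
    ⟨(mapsTo_Phi hpos unif_mem_densityPD.1 unif_mem_densityPD.1).mono_left
      densityPD_subset_density, fun X hX Y hY => hilbertDist_Theta_le hpos hX hY⟩,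
    F, ⟨hF, densityPD_subset_intrinsicInterior hF, hF_theta⟩,
    ε₁, hε₁, ε₂, hε₂, h_ball_unif, h_ball_F, h_Phi⟩
  rw [Complex.coe_smul, D_smul_left hX ht.ne', D_smul_left hY ht.ne']
  exact ⟨(D_mem_densityPD .one hX).1, hilbertDist_D_one hX hY⟩

theorem theorem5p1 (n k : ℕ) (hn : 0 < n) (A : Fin k → Matrix (Fin n) (Fin n) ℂ)
    (hchan : QBridge.IsChannel A) (hpos : QBridge.IsPositive A) :
    -- 1: `Q` and `Q̃` are strict contractions on positive definite matrices
    ((0 ≤ QBridge.kappa A ∧ QBridge.kappa A < 1) ∧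
      ∀ X Y : Matrix (Fin n) (Fin n) ℂ, X.PosDef → Y.PosDef →
        (QBridge.Q A X).PosDef ∧ (QBridge.Qtilde A X).PosDef ∧
        QBridge.hilbertDist (QBridge.Q A X) (QBridge.Q A Y)
          ≤ QBridge.kappa A * QBridge.hilbertDist X Y ∧
        QBridge.hilbertDist (QBridge.Qtilde A X) (QBridge.Qtilde A Y)
          ≤ QBridge.kappa A * QBridge.hilbertDist X Y) ∧
    -- 2: `D_{tI}` preserves the Hilbert metric
    (∀ t : ℝ, 0 < t → ∀ X Y : Matrix (Fin n) (Fin n) ℂ, X.PosDef → Y.PosDef →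
        (QBridge.D ((t : ℂ) • 1) X).PosDef ∧
        QBridge.hilbertDist (QBridge.D ((t : ℂ) • 1) X) (QBridge.D ((t : ℂ) • 1) Y)
          = QBridge.hilbertDist X Y) ∧
    -- 3: `Θ` is a contraction of the positive definite density matrices
    (Set.MapsTo (QBridge.Theta A) (QBridge.densityPD n) (QBridge.densityPD n) ∧
      ∀ X ∈ QBridge.densityPD n, ∀ Y ∈ QBridge.densityPD n,
        QBridge.hilbertDist (QBridge.Theta A X) (QBridge.Theta A Y)
          ≤ QBridge.kappa A ^ 2 * QBridge.hilbertDist X Y) ∧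
    -- 4: the unique fixed point `F` of `Θ`, which attracts every density matrix
    ∃ F : Matrix (Fin n) (Fin n) ℂ,
      (F ∈ QBridge.densityPD n ∧ F ∈ intrinsicInterior ℝ (QBridge.density n) ∧
        QBridge.Theta A F = F ∧
        (∀ X ∈ QBridge.density n, QBridge.Theta A X = X → X = F) ∧
        ∀ X ∈ QBridge.density n,
          Filter.Tendsto (fun m : ℕ => (QBridge.Theta A)^[m] X) Filter.atTop (nhds F)) ∧
      -- 5: balls around `I/n` and `F`
      ∃ ε₁ > 0, ∃ ε₂ > 0,
        QBridge.frobBall (QBridge.unif n) ε₁ ⊆ QBridge.densityPD n ∧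
        QBridge.frobBall F ε₂ ⊆ QBridge.densityPD n ∧
        ∀ α ∈ QBridge.frobBall (QBridge.unif n) ε₁, ∀ β ∈ QBridge.frobBall (QBridge.unif n) ε₁,
          ∃ U ∈ QBridge.frobBall F ε₂,
            QBridge.Phi A α β U = U ∧
            (∀ V ∈ QBridge.density n, QBridge.Phi A α β V = V → V = U) ∧
            ∀ X ∈ QBridge.frobBall F ε₂,
              Filter.Tendsto (fun m : ℕ => (QBridge.Phi A α β)^[m] X) Filter.atTop (nhds U) := by
  obtain ⟨h₁, h₂, h₃, F, hF, ε₁, hε₁, ε₂, hε₂, h_unif, h_F, h_Phi⟩ :=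
    theorem5p1_general n k hn A hpos
  refine ⟨h₁, h₂, h₃, F, hF, ε₁, hε₁, ε₂, hε₂, h_unif, h_F, fun α hα β hβ => ?_⟩
  obtain ⟨U, hU, hUΦ, h_unique, h_tendsto⟩ := h_Phi α hα β hβ
  exact ⟨U, hU, hUΦ, h_unique, fun X hX =>
    h_tendsto X (QBridge.densityPD_subset_density (h_F hX))⟩
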